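/- Conventions. A prefix-free machine is a partial computable function $M$ from finite binary strings to finite binary strings whose domain contains no string together with a proper extension of it. It is universal if for every prefix-free machine $N$ there is a string $\rho$ such that $M(\rho\sigma)=N(\sigma)$ (as partial values) for all strings $\sigma$. An omega number is a real of the form $\sum_{\sigma\in\mathrm{dom}(U)}2^{-|\sigma|}$, where $U$ is a universal prefix-free machine. The binary digits of a real in $[0,1)$ are indexed by $1,2,3,\dots$. A function $g:\mathbb{N}\to\mathbb{R}$ is computable if from $n$ and $k$ one can compute a rational number within $2^{-k}$ of $g(n)$. A real $\beta$ computes a real $\alpha$ with redundancy $g$ if a single Turing functional with oracle $\beta$ computes, for each $n$, the first $n$ binary digits of $\alpha$, using for this at most the first $\lfloor n+g(n)\rfloor$ binary digits of $\beta$. Lemma (Insufficient redundancy). Let $g:\mathbb{N}\to\mathbb{R}$ be a computable nondecreasing function and let $(t_i)_{i\in\mathbb{N}}$ be a computable, strictly increasing sequence of natural numbers such that $t_i+g(t_i)<t_{i+1}$ for all sufficiently large $i$, and $$\sum_i 2^{-g(t_i)}=\infty\qquad\text{and}\qquad \sum_i 2^{t_i-t_{i+1}}<\infty .$$ Then for every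 omega number $\Omega$ there exists another omega number $\beta\neq\Omega$ which is not computable from $\Omega$ with redundancy $g$. More precisely, there is a constant $c\in\mathbb{N}$ such that the number $$\beta=\Omega+\sum_{i>c}2^{-(t_i+\lfloor g(t_i)\rfloor+1)}$$ is such an omega number. -/

import Mathlib

namespace OmegaRedundancy

/-- The `k`-th binary digit (positions are numbered `1, 2, 3, …` after the binary point)
of a real number `α ∈ [0, 1)`: the parity of `⌊2 ^ k * α⌋`. -/
noncomputable def digit (α : ℝ) (k : ℕ) : Bool :=
  decide (⌊(2 : ℝ) ^ k * α⌋ % 2 = 1)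

/-- The string of the first `n` binary digits of `α`, at the positions `1, …, n`. -/
noncomputable def firstDigits (α : ℝ) (n : ℕ) : List Bool :=
  (List.range n).map fun i => digit α (i + 1)

/-- A prefix-free machine: a partial computable function from binary strings to binary strings
whose domain contains no string together with a proper extension of it. -/
def IsPrefixFreeMachine (M : List Bool →. List Bool) : Prop :=
  Partrec M ∧ ∀ σ τ : List Bool, (M σ).Dom → (M τ).Dom → σ <+: τ → σ = τ

/-- A universal prefix-free machine: every prefix-free machine `M` is simulated by `U` after
some coding string `ρ` has been put in front of the input (equality of partial values:
`U (ρ ++ σ)` halts exactly when `M σ` does, and then with the same output). -/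
def IsUniversalPrefixFreeMachine (U : List Bool →. List Bool) : Prop :=
  IsPrefixFreeMachine U ∧
    ∀ M : List Bool →. List Bool, IsPrefixFreeMachine M →
      ∃ ρ : List Bool, ∀ σ : List Bool, U (ρ ++ σ) = M σ

/-- `α` is the halting probability of `M`: the sum of `2 ^ (-|σ|)` over all `σ` on which `M`
halts. -/
def IsHaltingProbability (M : List Bool →. List Bool) (α : ℝ) : Prop :=
  HasSum (fun σ : {σ : List Bool // (M σ).Dom} => ((1 : ℝ) / 2) ^ (σ : List Bool).length) α

/-- An omega number: the halting probability of some universal prefix-free machine. -/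
def IsOmegaNumber (α : ℝ) : Prop :=
  ∃ U : List Bool →. List Bool, IsUniversalPrefixFreeMachine U ∧ IsHaltingProbability U α

/-- A computable function from natural numbers to reals: from `n` and `k` one can compute an
integer `z` (presented as the difference of two natural numbers) such that `z / 2 ^ k` is within
`2 ^ (-k)` of `g n`. -/
def IsComputableRealFunction (g : ℕ → ℝ) : Prop :=
  ∃ p q : ℕ → ℕ → ℕ, Computable₂ p ∧ Computable₂ q ∧
    ∀ n k : ℕ, |g n - ((p n k : ℝ) - (q n k : ℝ)) / 2 ^ k| ≤ ((1 : ℝ) / 2) ^ k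

/-- A Turing functional with string outputs: `Φ σ n` is the output of an oracle computation on
input `n` in which `σ` is the available initial segment of the oracle; it diverges if the
computation asks for an oracle bit beyond the end of `σ`. Hence a computation that converges
with `σ` converges to the same output with every extension of `σ`. -/
def IsTuringFunctional (Φ : List Bool → ℕ →. List Bool) : Prop :=
  Partrec₂ Φ ∧
    ∀ (σ τ : List Bool) (n : ℕ) (ρ : List Bool), σ <+: τ → ρ ∈ Φ σ n → ρ ∈ Φ τ n

/-- `β` computes `α` with redundancy `g`: some Turing functional with oracle `β` computes, for
each `n`, the first `n` binary digits of `α`, and uses for this at most the first `⌊n + g n⌋`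
binary digits of `β` (none of them if `⌊n + g n⌋` is negative). -/
def ComputesWithRedundancy (β α : ℝ) (g : ℕ → ℝ) : Prop :=
  ∃ Φ : List Bool → ℕ →. List Bool, IsTuringFunctional Φ ∧
    ∀ n : ℕ, firstDigits α n ∈ Φ (firstDigits β ⌊(n : ℝ) + g n⌋.toNat) n

end OmegaRedundancy

/-! Let `u j = T j + ⌊g (T j)⌋`, where `T` is a tail of `t`, and let `γ` be the sum of `2^(-(u j +
1))`, so that `β = Ω + γ`.

Why `β` is an omega number: it is the mean of `Ω` and `Ω + 2γ`. Both are limits from below of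
computable sequences of dyadic rationals, and `Ω + 2γ ≤ 1` once the tail is short. Hence `Ω + 2γ` is
the measure of a computable prefix-free set, and this set, placed under `false`, is joined to a
universal machine placed under `true` (`isOmegaNumber_add`).

Why `Ω` does not compute `β`: with redundancy `g`, the digit of `β` at a position `n` a constant
below `T j` is predicted from the first `u j` digits of `Ω`, while the summand `2^(-(u j + 1))` sits
just after them. If `Ω` has only ones from position `n + 1` up to about `u j`, the carry into
position `n` depends on digits that the functional has not seen. So above each prefix of length `n`
some extension refutes the prediction (`exists_not_passes`), although `Ω` itself never does
(`passes_of_digit`). Level `j` thus excludes a proportion of strings that is at least a constant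
times `2^(-g (T j))`. Since these sum to infinity, passing all levels is an effectively null
condition (`card_survivors_mul_le`, `exists_prod_mul_le`), which contradicts the randomness of `Ω`
(`exists_not_enumerated`).

Two complications shape the details. The number `⌊g (T j)⌋` need not be computable from
approximations, so a level uses a computable `w j ∈ {u j, u j + 1}` and tests predictions from both
possible lengths. And levels must read disjoint blocks of digits: overlapping ones are discarded, at
a cost bounded by the convergent series `∑ 2^(t i - t (i+1))` (`not_summable_retained`).

Randomness is proved directly: a machine that knows its own coding prefix inside the universal
machine adds measure whenever the approximation to `Ω` is about to enter an enumerated interval. -/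

namespace OmegaRedundancy

/-! ### Closure properties of computable functions, and stagewise approximation. -/

section Computability

variable {α σ : Type*} [Primcodable α] [Primcodable σ]

theorem computable_add {f g : α → ℕ} (hf : Computable f) (hg : Computable g) :
    Computable fun a => f a + g a := Primrec.nat_add.to_comp.comp hf hg

theorem computable_sub {f g : α → ℕ} (hf : Computable f) (hg : Computable g) :
    Computable fun a => f a - g a := Primrec.nat_sub.to_comp.comp hf hg

theorem computable_mul {f g : α → ℕ} (hf : Computable f) (hg : Computable g) :
    Computable fun a => f a * g a := Primrec.nat_mul.to_comp.comp hf hg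

theorem computable_div {f g : α → ℕ} (hf : Computable f) (hg : Computable g) :
    Computable fun a => f a / g a := Primrec.nat_div.to_comp.comp hf hg

theorem computable_mod {f g : α → ℕ} (hf : Computable f) (hg : Computable g) :
    Computable fun a => f a % g a := Primrec.nat_mod.to_comp.comp hf hg

theorem computable_max {f g : α → ℕ} (hf : Computable f) (hg : Computable g) :
    Computable fun a => max (f a) (g a) := Primrec.nat_max.to_comp.comp hf hg

theorem computable_pow {f g : α → ℕ} (hf : Computable f) (hg : Computable g) :
    Computable fun a => f a ^ g a := by
  have h : Primrec₂ ((· ^ ·) : ℕ → ℕ → ℕ) := Primrec₂.unpaired'.1 Nat.Primrec.pow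
  exact h.to_comp.comp hf hg

theorem computable_two_pow {f : α → ℕ} (hf : Computable f) :
    Computable fun a => 2 ^ f a := computable_pow (Computable.const 2) hf

theorem computable_le {f g : α → ℕ} (hf : Computable f) (hg : Computable g) :
    Computable fun a => decide (f a ≤ g a) := by
  have h : Primrec₂ fun a b : ℕ => decide (a ≤ b) := Primrec.nat_le.decide
  exact h.to_comp.comp hf hg

theorem computable_lt {f g : α → ℕ} (hf : Computable f) (hg : Computable g) :
    Computable fun a => decide (f a < g a) := by
  have h : Primrec₂ fun a b : ℕ => decide (a < b) := Primrec.nat_lt.decide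
  exact h.to_comp.comp hf hg

theorem computable_eq {β : Type*} [Primcodable β] [DecidableEq β] {f g : α → β}
    (hf : Computable f) (hg : Computable g) :
    Computable fun a => decide (f a = g a) := by
  have h : Primrec₂ fun a b : β => decide (a = b) := Primrec.eq.decide
  exact h.to_comp.comp hf hg

theorem computable_and {f g : α → Bool} (hf : Computable f) (hg : Computable g) :
    Computable fun a => f a && g a := Primrec.and.to_comp.comp hf hg

theorem computable_or {f g : α → Bool} (hf : Computable f) (hg : Computable g) :
    Computable fun a => f a || g a := Primrec.or.to_comp.comp hf hg

theorem computable_not {f : α → Bool} (hf : Computable f) :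
    Computable fun a => !f a := Primrec.not.to_comp.comp hf

theorem computable_ite {c : α → Bool} {f g : α → σ} (hc : Computable c) (hf : Computable f)
    (hg : Computable g) : Computable fun a => if c a = true then f a else g a :=
  (Computable.cond hc hf hg).of_eq fun a => by cases c a <;> rfl

theorem computable₃_comp {β γ δ : Type*} [Primcodable β] [Primcodable γ] [Primcodable δ]
    {F : β → γ → δ → σ} (hF : Computable fun p : β × γ × δ => F p.1 p.2.1 p.2.2)
    {f : α → β} {g : α → γ} {h : α → δ} (hf : Computable f) (hg : Computable g)
    (hh : Computable h) : Computable fun a => F (f a) (g a) (h a) := by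
  have := hF.comp (hf.pair (hg.pair hh))
  exact this

theorem computable_sum {N : α → ℕ} {f : α → ℕ → ℕ} (hN : Computable N) (hf : Computable₂ f) :
    Computable fun a => ∑ i ∈ Finset.range (N a), f a i := by
  have h : Computable₂ fun (a : α) (p : ℕ × ℕ) => p.2 + f a p.1 :=
    computable_add (Computable.snd.comp Computable.snd)
      (hf.comp Computable.fst (Computable.fst.comp Computable.snd))
  refine (Computable.nat_rec hN (Computable.const 0) h).of_eq fun a => ?_
  induction N a with
  | zero => rfl
  | succ n ih => rw [Finset.sum_range_succ, ← ih]

theorem computable_forall_lt {N : α → ℕ} {f : α → ℕ → Bool} (hN : Computable N)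
    (hf : Computable₂ f) : Computable fun a => decide (∀ i < N a, f a i = true) := by
  have h : Computable₂ fun (a : α) (p : ℕ × Bool) => p.2 && f a p.1 :=
    computable_and (Computable.snd.comp Computable.snd)
      (hf.comp Computable.fst (Computable.fst.comp Computable.snd))
  refine (Computable.nat_rec hN (Computable.const true) h).of_eq fun a => ?_
  induction N a with
  | zero => simp
  | succ n ih =>
    change (_ && f a n) = _
    rw [ih, Bool.eq_iff_iff]
    simp only [Bool.and_eq_true, decide_eq_true_eq]
    exact Nat.forall_lt_succ_right.symm

/-- Stagewise approximation of a partial computable function. -/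
theorem exists_stage {f : α →. σ} (hf : Partrec f) :
    ∃ F : ℕ → α → Option σ, Computable₂ F ∧
      (∀ s s' a y, s ≤ s' → y ∈ F s a → y ∈ F s' a) ∧
      ∀ a y, y ∈ f a ↔ ∃ s, y ∈ F s a := by
  obtain ⟨c, hc⟩ := Nat.Partrec.Code.exists_code.1 hf
  refine ⟨fun s a => (Nat.Partrec.Code.evaln s c (Encodable.encode a)).bind Encodable.decode,
    ?_, ?_, ?_⟩
  · have h : Computable fun p : ℕ × α =>
        Nat.Partrec.Code.evaln p.1 c (Encodable.encode p.2) :=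
      Nat.Partrec.Code.primrec_evaln.to_comp.comp
        ((Computable.fst.pair (Computable.const c)).pair
          (Computable.encode.comp Computable.snd))
    exact Computable.option_bind h (Computable.decode.comp Computable.snd)
  · intro s s' a y hs hy
    simp only [Option.mem_def, Option.bind_eq_some_iff] at hy ⊢
    obtain ⟨m, hm, hy⟩ := hy
    exact ⟨m, Nat.Partrec.Code.evaln_mono hs hm, hy⟩
  · intro a y
    have hev : Nat.Partrec.Code.eval c (Encodable.encode a) = (f a).map Encodable.encode := by
      rw [hc]; simp
    simp only [Option.mem_def, Option.bind_eq_some_iff]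
    constructor
    · intro hy
      have : Encodable.encode y ∈ Nat.Partrec.Code.eval c (Encodable.encode a) := by
        rw [hev]; exact Part.mem_map _ hy
      obtain ⟨k, hk⟩ := Nat.Partrec.Code.evaln_complete.1 this
      exact ⟨k, _, hk, Encodable.encodek _⟩
    · rintro ⟨k, m, hm, hy⟩
      have h := Nat.Partrec.Code.evaln_sound hm
      rw [hev, Part.mem_map_iff] at h
      obtain ⟨y', hy', rfl⟩ := h
      rw [Encodable.encodek] at hy
      exact Option.some_injective _ hy ▸ hy'

end Computability

/-! ### Binary strings, their numbers, and digits of reals. -/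

/-- The `n` binary digits of the dyadic rational `m / 2 ^ n`. -/
def bits (m n : ℕ) : List Bool :=
  (List.range n).map fun i => decide (m / 2 ^ (n - 1 - i) % 2 = 1)

/-- The natural number with the given binary digits. -/
def num (l : List Bool) : ℕ := l.foldl (fun k b => 2 * k + b.toNat) 0

@[simp] theorem length_bits (m n : ℕ) : (bits m n).length = n := by simp [bits]

theorem bits_succ (m n : ℕ) : bits m (n + 1) = bits (m / 2) n ++ [decide (m % 2 = 1)] := by
  unfold bits
  rw [List.range_succ, List.map_append]
  congr 1
  · refine List.map_congr_left fun i hi => ?_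
    have hi : i < n := List.mem_range.1 hi
    have h : n + 1 - 1 - i = (n - 1 - i) + 1 := by omega
    rw [h, pow_succ', Nat.div_div_eq_div_mul]
  · simp

@[simp] theorem num_nil : num [] = 0 := rfl

theorem num_concat (l : List Bool) (b : Bool) : num (l ++ [b]) = 2 * num l + b.toNat := by
  simp [num, List.foldl_append]

theorem num_lt (l : List Bool) : num l < 2 ^ l.length := by
  induction l using List.reverseRecOn with
  | nil => simp
  | append_singleton l b ih =>
    rw [num_concat, List.length_append, List.length_singleton, pow_succ]
    have := Bool.toNat_lt b
    omega

theorem num_append (l l' : List Bool) : num (l ++ l') = num l * 2 ^ l'.length + num l' := by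
  induction l' using List.reverseRecOn with
  | nil => simp
  | append_singleton l' b ih =>
    rw [← List.append_assoc, num_concat, num_concat, ih, List.length_append,
      List.length_singleton, pow_succ]
    ring

theorem num_bits {m n : ℕ} (h : m < 2 ^ n) : num (bits m n) = m := by
  induction n generalizing m with
  | zero => simp at h; subst h; rfl
  | succ n ih =>
    rw [bits_succ, num_concat, ih (by rw [pow_succ] at h; omega)]
    rcases Nat.mod_two_eq_zero_or_one m with h | h <;> simp [h] <;> omega

theorem bits_num (l : List Bool) : bits (num l) l.length = l := by
  induction l using List.reverseRecOn with
  | nil => rfl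
  | append_singleton l b ih =>
    rw [List.length_append, List.length_singleton, bits_succ, num_concat]
    have h1 : (2 * num l + b.toNat) / 2 = num l := by
      have := Bool.toNat_lt b; omega
    rw [h1, ih]
    cases b <;> simp

theorem bits_div_prefix (m n k : ℕ) : bits (m / 2 ^ k) n <+: bits m (n + k) := by
  induction k generalizing m with
  | zero => simp
  | succ k ih =>
    rw [← add_assoc, bits_succ, pow_succ', ← Nat.div_div_eq_div_mul]
    exact (ih _).trans (List.prefix_append _ _)

theorem computable_bits : Computable₂ bits := by
  have h : Primrec₂ ((· ^ ·) : ℕ → ℕ → ℕ) := Primrec₂.unpaired'.1 Nat.Primrec.pow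
  have h1 : Primrec fun q : (ℕ × ℕ) × ℕ => q.1.1 / 2 ^ (q.1.2 - 1 - q.2) % 2 :=
    Primrec.nat_mod.comp (Primrec.nat_div.comp (Primrec.fst.comp Primrec.fst)
      (h.comp (Primrec.const 2) (Primrec.nat_sub.comp
        (Primrec.nat_sub.comp (Primrec.snd.comp Primrec.fst) (Primrec.const 1))
        Primrec.snd))) (Primrec.const 2)
  have h2 : Primrec₂ fun a b : ℕ => decide (a = b) := Primrec.eq.decide
  have h3 : Primrec₂ fun (p : ℕ × ℕ) (i : ℕ) => decide (p.1 / 2 ^ (p.2 - 1 - i) % 2 = 1) :=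
    h2.comp h1 (Primrec.const 1)
  exact (Primrec.list_map (f := fun p : ℕ × ℕ => List.range p.2)
    (Primrec.list_range.comp Primrec.snd) h3).to_comp

theorem computable_num : Computable num := by
  have h : Primrec₂ fun (_ : List Bool) (p : ℕ × Bool) => 2 * p.1 + p.2.toNat :=
    Primrec.nat_add.comp (Primrec.nat_mul.comp (Primrec.const 2)
      (Primrec.fst.comp Primrec.snd))
      ((Primrec.dom_bool Bool.toNat).comp (Primrec.snd.comp Primrec.snd))
  exact (Primrec.list_foldl Primrec.id (Primrec.const 0) h).to_comp

theorem firstDigits_eq_bits {x : ℝ} (hx : 0 ≤ x) (n : ℕ) :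
    firstDigits x n = bits ⌊(2 : ℝ) ^ n * x⌋₊ n := by
  unfold firstDigits bits
  refine List.map_congr_left fun i hi => ?_
  have hi : i < n := List.mem_range.1 hi
  have h1 : ⌊(2 : ℝ) ^ n * x⌋₊ / 2 ^ (n - 1 - i) = ⌊(2 : ℝ) ^ (i + 1) * x⌋₊ := by
    rw [← Nat.floor_div_natCast]
    congr 1
    rw [div_eq_iff (by positivity)]
    push_cast
    have : n = (i + 1) + (n - 1 - i) := by omega
    conv_lhs => rw [this, pow_add]
    ring
  rw [h1]
  unfold digit
  have h2 : ⌊(2 : ℝ) ^ (i + 1) * x⌋ = (⌊(2 : ℝ) ^ (i + 1) * x⌋₊ : ℤ) :=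
    (Int.natCast_floor_eq_floor (by positivity)).symm
  rw [h2, Bool.eq_iff_iff]
  simp only [decide_eq_true_eq]
  omega

theorem firstDigits_prefix (x : ℝ) {m n : ℕ} (h : m ≤ n) :
    firstDigits x m <+: firstDigits x n := by
  obtain ⟨k, rfl⟩ := Nat.exists_eq_add_of_le h
  unfold firstDigits
  rw [List.range_add, List.map_append]
  exact List.prefix_append _ _

/-! ### Prefix-free sets of prescribed measure. -/

/-- The weight `2 ^ (-|σ|)` of a string. -/
noncomputable def weight (σ : List Bool) : ℝ := ((1 : ℝ) / 2) ^ σ.length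

theorem weight_nonneg (σ : List Bool) : 0 ≤ weight σ := by unfold weight; positivity

theorem weight_append (σ τ : List Bool) : weight (σ ++ τ) = weight σ * weight τ := by
  simp [weight, pow_add]

theorem isHaltingProbability_iff (M : List Bool →. List Bool) (α : ℝ) :
    IsHaltingProbability M α ↔ HasSum (Set.indicator {σ | (M σ).Dom} weight) α :=
  hasSum_subtype_iff_indicator (f := weight)

/-- The strings `τ` whose dyadic interval lies in
`[a (|τ| - 1) / 2 ^ (|τ| - 1), a |τ| / 2 ^ |τ|)`. -/
def cut (a : ℕ → ℕ) (τ : List Bool) : Bool :=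
  decide (2 * a (τ.length - 1) ≤ num τ) && decide (num τ < a τ.length)

theorem cut_eq_true_iff {a : ℕ → ℕ} {τ : List Bool} :
    cut a τ = true ↔ 2 * a (τ.length - 1) ≤ num τ ∧ num τ < a τ.length := by
  simp [cut]

theorem two_pow_mul_le {a : ℕ → ℕ} (ha : ∀ s, 2 * a s ≤ a (s + 1)) (s k : ℕ) :
    2 ^ k * a s ≤ a (s + k) := by
  induction k with
  | zero => simp
  | succ k ih =>
    have := ha (s + k)
    rw [pow_succ, ← add_assoc]
    linarith

/-- The dyadic interval of `σ` ends at or before `a |σ| / 2^|σ|`. A proper extension `τ` starts at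
or after `a (|τ| - 1) / 2^(|τ| - 1)`, which is no smaller, so the two intervals are disjoint. -/
theorem cut_prefixFree {a : ℕ → ℕ} (ha : ∀ s, 2 * a s ≤ a (s + 1)) {σ τ : List Bool}
    (hσ : cut a σ = true) (hτ : cut a τ = true) (h : σ <+: τ) : σ = τ := by
  obtain ⟨ρ, rfl⟩ := h
  rw [cut_eq_true_iff] at hσ hτ
  rcases ρ.eq_nil_or_concat with rfl | ⟨ρ, b, rfl⟩
  · simp
  exfalso
  rw [List.concat_eq_append] at hτ
  have h1 := hτ.1
  rw [num_append] at h1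
  have h2 := num_lt (ρ ++ [b])
  simp only [List.length_append, List.length_singleton] at h1 h2
  have h3 := two_pow_mul_le ha σ.length ρ.length
  have h4 : σ.length + (ρ.length + 1) - 1 = σ.length + ρ.length := by omega
  rw [h4] at h1
  have h5 : (num σ + 1) * 2 ^ (ρ.length + 1) ≤ a σ.length * 2 ^ (ρ.length + 1) :=
    Nat.mul_le_mul_right _ hσ.2
  rw [pow_succ] at h1 h2 h5
  nlinarith

/-- The cut strings of length `n` fill the stretch from `a (n-1) / 2^(n-1)` to `a n / 2^n`, so the
lengths up to `N` telescope to `a N / 2^N`; `a 0 = 0` means that nothing precedes the first stretch.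
-/
theorem hasSum_cut {a : ℕ → ℕ} (h0 : a 0 = 0) (ha : ∀ s, 2 * a s ≤ a (s + 1))
    (hle : ∀ s, a s ≤ 2 ^ s) {x : ℝ}
    (hx : Filter.Tendsto (fun s => (a s : ℝ) / 2 ^ s) Filter.atTop (nhds x)) :
    HasSum (Set.indicator {τ | cut a τ = true} weight) x := by
  classical
  set f := Set.indicator {τ | cut a τ = true} weight with hf
  have hf0 : ∀ τ, 0 ≤ f τ := fun τ => Set.indicator_nonneg (fun τ _ => weight_nonneg τ) τ
  let J : ℕ → Finset (List Bool) := fun n =>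
    (Finset.Ico (2 * a (n - 1)) (a n)).image fun m => bits m n
  have hJ : ∀ n τ, τ ∈ J n ↔ τ.length = n ∧ cut a τ = true := by
    intro n τ
    simp only [J, Finset.mem_image, Finset.mem_Ico, cut_eq_true_iff]
    constructor
    · rintro ⟨m, ⟨h1, h2⟩, rfl⟩
      have h3 : num (bits m n) = m := num_bits (h2.trans_le (hle n))
      simp [h1, h2, h3]
    · rintro ⟨rfl, h⟩
      exact ⟨num τ, h, bits_num τ⟩
  have hsum : ∀ n, ∑ τ ∈ J n, f τ = ((a n : ℝ) - 2 * a (n - 1)) / 2 ^ n := by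
    intro n
    have h1 : ∀ τ ∈ J n, f τ = (1 / 2 : ℝ) ^ n := by
      intro τ hτ
      obtain ⟨h1, h2⟩ := (hJ n τ).1 hτ
      rw [hf, Set.indicator_of_mem (by exact h2), weight, h1]
    rw [Finset.sum_congr rfl h1, Finset.sum_const, Finset.card_image_of_injOn, Nat.card_Ico,
      nsmul_eq_mul, Nat.cast_sub]
    · push_cast; rw [one_div, inv_pow]; ring
    · rcases n with _ | n
      · simp [h0]
      · exact ha n
    · intro m hm m' hm' h
      simp only [Finset.coe_Ico, Set.mem_Ico] at hm hm'
      have := congrArg num h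
      simpa [num_bits (hm.2.trans_le (hle n)), num_bits (hm'.2.trans_le (hle n))] using this
  let S : ℕ → Finset (List Bool) := fun N => (Finset.range (N + 1)).biUnion J
  have hS : ∀ N, ∑ τ ∈ S N, f τ = (a N : ℝ) / 2 ^ N := by
    intro N
    rw [Finset.sum_biUnion]
    · simp only [hsum]
      induction N with
      | zero => simp [h0]
      | succ N ih =>
        rw [Finset.sum_range_succ, ih, Nat.add_sub_cancel, pow_succ]
        field_simp
        ring
    · intro i _ j _ hij
      refine Finset.disjoint_left.2 fun τ h1 h2 => hij ?_
      rw [← ((hJ i τ).1 h1).1, ((hJ j τ).1 h2).1]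
  have hmono : Monotone fun s => (a s : ℝ) / 2 ^ s := by
    refine monotone_nat_of_le_succ fun s => ?_
    rw [div_le_div_iff₀ (by positivity) (by positivity), pow_succ]
    have : (2 : ℝ) * a s ≤ a (s + 1) := by exact_mod_cast ha s
    nlinarith [pow_pos (two_pos : (0 : ℝ) < 2) s]
  refine hasSum_of_isLUB_of_nonneg x hf0 ⟨?_, ?_⟩
  · rintro _ ⟨T, rfl⟩
    set N := T.sup List.length
    refine le_trans ?_ (hmono.ge_of_tendsto hx N)
    change _ ≤ (a N : ℝ) / 2 ^ N
    rw [← hS N]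
    calc ∑ τ ∈ T, f τ = ∑ τ ∈ T.filter (fun τ => cut a τ = true), f τ := by
          rw [Finset.sum_filter]
          refine Finset.sum_congr rfl fun τ _ => ?_
          split_ifs with h
          · rfl
          · rw [hf, Set.indicator_of_notMem (by exact h)]
      _ ≤ ∑ τ ∈ S N, f τ := by
          refine Finset.sum_le_sum_of_subset_of_nonneg ?_ fun τ _ _ => hf0 τ
          intro τ hτ
          rw [Finset.mem_filter] at hτ
          refine Finset.mem_biUnion.2 ⟨τ.length, ?_, (hJ _ _).2 ⟨rfl, hτ.2⟩⟩
          rw [Finset.mem_range, Nat.lt_succ_iff]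
          exact Finset.le_sup (f := List.length) hτ.1
  · intro b hb
    refine le_of_tendsto' hx fun s => ?_
    rw [← hS s]
    exact hb ⟨S s, rfl⟩

/-! ### Halting probabilities as limits from below. -/

/-- The strings of length less than `s`. -/
def shortStrings (s : ℕ) : Finset (List Bool) :=
  (Finset.range s).biUnion fun n => (Finset.range (2 ^ n)).image fun m => bits m n

theorem mem_shortStrings {s : ℕ} {σ : List Bool} : σ ∈ shortStrings s ↔ σ.length < s := by
  simp only [shortStrings, Finset.mem_biUnion, Finset.mem_range, Finset.mem_image]
  constructor
  · rintro ⟨n, hn, m, hm, rfl⟩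
    simpa using hn
  · exact fun h => ⟨σ.length, h, num σ, num_lt σ, bits_num σ⟩

theorem sum_shortStrings {R : Type*} [AddCommMonoid R] (f : List Bool → R) (s : ℕ) :
    ∑ σ ∈ shortStrings s, f σ = ∑ n ∈ Finset.range s, ∑ m ∈ Finset.range (2 ^ n), f (bits m n) := by
  unfold shortStrings
  rw [Finset.sum_biUnion]
  · refine Finset.sum_congr rfl fun n _ => Finset.sum_image fun m hm m' hm' h => ?_
    have := congrArg num h
    rwa [num_bits (by simpa using hm), num_bits (by simpa using hm')] at this
  · intro i _ j _ hij
    refine Finset.disjoint_left.2 fun τ h1 h2 => hij ?_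
    simp only [Finset.mem_image] at h1 h2
    obtain ⟨_, _, rfl⟩ := h1
    obtain ⟨_, _, h⟩ := h2
    simpa using congrArg List.length h.symm

/-- The measure, in units of `2 ^ (-s)`, of the strings that have been enumerated by stage `s`. -/
def stageMeasure (F : ℕ → List Bool → Bool) (s : ℕ) : ℕ :=
  ∑ σ ∈ shortStrings s, if F s σ = true then 2 ^ (s - σ.length) else 0

theorem computable_stageMeasure {E : Type*} [Primcodable E] {F : E → ℕ → List Bool → Bool}
    (hF : Computable fun p : E × ℕ × List Bool => F p.1 p.2.1 p.2.2) :
    Computable₂ fun e s => stageMeasure (F e) s := by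
  have hs : Computable fun q : ((E × ℕ) × ℕ) × ℕ => q.1.1.2 :=
    Computable.snd.comp (Computable.fst.comp Computable.fst)
  have hn : Computable fun q : ((E × ℕ) × ℕ) × ℕ => q.1.2 :=
    Computable.snd.comp Computable.fst
  have hσ : Computable fun q : ((E × ℕ) × ℕ) × ℕ => bits q.2 q.1.2 :=
    computable_bits.comp Computable.snd hn
  have hc : Computable fun q : ((E × ℕ) × ℕ) × ℕ => F q.1.1.1 q.1.1.2 (bits q.2 q.1.2) :=
    computable₃_comp hF (Computable.fst.comp (Computable.fst.comp Computable.fst)) hs hσ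
  have hi : Computable₂ fun (p : (E × ℕ) × ℕ) (m : ℕ) =>
      if F p.1.1 p.1.2 (bits m p.2) = true then 2 ^ (p.1.2 - p.2) else 0 :=
    computable_ite hc (computable_two_pow (computable_sub hs hn)) (Computable.const 0)
  have h2 : Computable₂ fun (p : E × ℕ) (n : ℕ) => ∑ m ∈ Finset.range (2 ^ n),
      if F p.1 p.2 (bits m n) = true then 2 ^ (p.2 - n) else 0 :=
    computable_sum (N := fun p : (E × ℕ) × ℕ => 2 ^ p.2) (computable_two_pow Computable.snd) hi
  refine Computable.of_eq (computable_sum (N := fun p : E × ℕ => p.2) Computable.snd h2)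
    fun p => ?_
  simp only [stageMeasure, sum_shortStrings, length_bits]

theorem two_mul_stageMeasure_le {F : ℕ → List Bool → Bool}
    (hF : ∀ s s' σ, s ≤ s' → F s σ = true → F s' σ = true) (s : ℕ) :
    2 * stageMeasure F s ≤ stageMeasure F (s + 1) := by
  unfold stageMeasure
  rw [Finset.mul_sum]
  refine (Finset.sum_le_sum fun σ hσ => ?_).trans
    (Finset.sum_le_sum_of_subset (M := ℕ) fun σ hσ => ?_)
  · rw [mem_shortStrings] at hσ
    split_ifs with h1 h2 h2
    · rw [← pow_succ']
      exact Nat.pow_le_pow_right two_pos (by omega)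
    · exact absurd (hF s (s + 1) _ (Nat.le_succ s) h1) h2
    · simp
    · simp
  · rw [mem_shortStrings] at hσ ⊢
    omega

theorem stageMeasure_div (F : ℕ → List Bool → Bool) (s : ℕ) :
    (stageMeasure F s : ℝ) / 2 ^ s =
      ∑ σ ∈ shortStrings s, if F s σ = true then weight σ else 0 := by
  unfold stageMeasure
  push_cast
  rw [Finset.sum_div]
  refine Finset.sum_congr rfl fun σ hσ => ?_
  rw [mem_shortStrings] at hσ
  split_ifs with h
  · rw [weight, one_div, inv_pow, div_eq_iff (by positivity),
      pow_sub₀ (2 : ℝ) two_ne_zero hσ.le]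
    ring
  · simp

theorem stageMeasure_le {F : ℕ → List Bool → Bool} {x : ℝ}
    (hx : HasSum (Set.indicator {σ | ∃ s, F s σ = true} weight) x) (s : ℕ) :
    (stageMeasure F s : ℝ) / 2 ^ s ≤ x := by
  rw [stageMeasure_div]
  have hnn := fun σ => Set.indicator_nonneg (s := {σ | ∃ s, F s σ = true})
    (fun τ _ => weight_nonneg τ) σ
  refine le_trans (Finset.sum_le_sum fun σ _ => ?_)
    (sum_le_hasSum (shortStrings s) (fun σ _ => hnn σ) hx)
  split_ifs with h1
  · rw [Set.indicator_of_mem (by exact ⟨s, h1⟩)]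
  · exact hnn σ

theorem tendsto_stageMeasure {F : ℕ → List Bool → Bool}
    (hF : ∀ s s' σ, s ≤ s' → F s σ = true → F s' σ = true) {x : ℝ}
    (hx : HasSum (Set.indicator {σ | ∃ s, F s σ = true} weight) x) :
    Filter.Tendsto (fun s => (stageMeasure F s : ℝ) / 2 ^ s) Filter.atTop (nhds x) := by
  refine tendsto_order.2 ⟨fun y hy => ?_, fun y hy =>
    Filter.Eventually.of_forall fun s => (stageMeasure_le hx s).trans_lt hy⟩
  -- A finite set of strings whose enumerated members already weigh more than `y`; some stage has
  -- enumerated all of these and exceeds all their lengths.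
  obtain ⟨T, hT⟩ := (Filter.Tendsto.eventually hx (lt_mem_nhds hy)).exists
  have hev : ∀ σ, ∀ᶠ s in Filter.atTop,
      Set.indicator {σ | ∃ s, F s σ = true} weight σ ≤
      if F s σ = true then weight σ else 0 := by
    intro σ
    by_cases hm : ∃ s, F s σ = true
    · obtain ⟨s₀, hs₀⟩ := hm
      filter_upwards [Filter.eventually_ge_atTop s₀] with s h1
      rw [Set.indicator_of_mem (by exact ⟨s₀, hs₀⟩), if_pos (hF s₀ s _ h1 hs₀)]
    · refine Filter.Eventually.of_forall fun s => ?_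
      rw [Set.indicator_of_notMem (by exact hm)]
      split_ifs
      exacts [weight_nonneg _, le_rfl]
  have hall : ∀ᶠ s in Filter.atTop, ∀ σ ∈ T,
      Set.indicator {σ | ∃ s, F s σ = true} weight σ ≤
      if F s σ = true then weight σ else 0 :=
    (Finset.eventually_all _).2 fun σ _ => hev σ
  filter_upwards [hall, Filter.eventually_gt_atTop (T.sup List.length)] with s h1 h2
  refine hT.trans_le ((Finset.sum_le_sum h1).trans ?_)
  rw [stageMeasure_div]
  refine Finset.sum_le_sum_of_subset_of_nonneg (fun σ hσ => ?_) fun σ _ _ => ?_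
  · exact mem_shortStrings.2 ((Finset.le_sup (f := List.length) hσ).trans_lt h2)
  · split_ifs
    exacts [weight_nonneg _, le_rfl]

/-- A computable sequence of dyadic rationals `a s / 2 ^ s` that approximates `x` from below. -/
structure ApproximatesFromBelow (a : ℕ → ℕ) (x : ℝ) : Prop where
  computable : Computable a
  le : ∀ s, (a s : ℝ) / 2 ^ s ≤ x
  tendsto : Filter.Tendsto (fun s => (a s : ℝ) / 2 ^ s) Filter.atTop (nhds x)

/-- The domain of a machine, enumerated in stages. -/
theorem exists_enumeration {M : List Bool →. List Bool} (hM : Partrec M) :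
    ∃ F : ℕ → List Bool → Bool, Computable₂ F ∧
      (∀ s s' σ, s ≤ s' → F s σ = true → F s' σ = true) ∧
      ∀ σ, (∃ s, F s σ = true) ↔ (M σ).Dom := by
  obtain ⟨F, hF, hmono, hmem⟩ := exists_stage hM
  refine ⟨fun s σ => (F s σ).isSome, Primrec.option_isSome.to_comp.comp hF, ?_, ?_⟩
  · intro s s' σ hs h
    obtain ⟨y, hy⟩ := Option.isSome_iff_exists.1 h
    exact Option.isSome_iff_exists.2 ⟨y, hmono s s' σ y hs hy⟩
  · intro σ
    rw [Part.dom_iff_mem]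
    constructor
    · rintro ⟨s, h⟩
      obtain ⟨y, hy⟩ := Option.isSome_iff_exists.1 h
      exact ⟨y, (hmem σ y).2 ⟨s, hy⟩⟩
    · rintro ⟨y, hy⟩
      obtain ⟨s, hs⟩ := (hmem σ y).1 hy
      exact ⟨s, Option.isSome_iff_exists.2 ⟨y, hs⟩⟩

theorem exists_approximatesFromBelow {M : List Bool →. List Bool} (hM : Partrec M) {x : ℝ}
    (hx : IsHaltingProbability M x) : ∃ a, ApproximatesFromBelow a x := by
  obtain ⟨F, hF, hmono, hmem⟩ := exists_enumeration hM
  have hset : {σ | (M σ).Dom} = {σ | ∃ s, F s σ = true} := by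
    ext σ; exact (hmem σ).symm
  rw [isHaltingProbability_iff, hset] at hx
  refine ⟨stageMeasure F, ?_, stageMeasure_le hx, tendsto_stageMeasure hmono hx⟩
  have h : Computable fun p : Unit × ℕ × List Bool => F p.2.1 p.2.2 :=
    hF.comp (Computable.fst.comp Computable.snd) (Computable.snd.comp Computable.snd)
  exact (computable_stageMeasure (F := fun _ : Unit => F) h).comp
    (Computable.const ()) Computable.id

/-! ### Kraft's inequality, and omega numbers are below `1`. -/

/-- The first words of two factorizations of one string are both prefixes of it, hence comparable,
hence equal. The empty word has to be excluded because it can be repeated freely. -/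
theorem uniquelyDecodable_of_prefixFree {S : Set (List Bool)} (h0 : [] ∉ S)
    (h : ∀ σ ∈ S, ∀ τ ∈ S, σ <+: τ → σ = τ) : InformationTheory.UniquelyDecodable S := by
  intro L₁
  induction L₁ with
  | nil =>
    rintro (_ | ⟨τ, L₂⟩) _ h2 heq
    · rfl
    · have h3 : τ ∈ S := h2 τ (by simp)
      simp only [List.flatten_nil, List.flatten_cons] at heq
      have h4 : τ = [] := (List.append_eq_nil_iff.1 heq.symm).1
      exact absurd (h4 ▸ h3) h0
  | cons σ L₁ ih =>
    rintro (_ | ⟨τ, L₂⟩) h1 h2 heq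
    · have h3 : σ ∈ S := h1 σ (by simp)
      simp only [List.flatten_nil, List.flatten_cons] at heq
      have h4 : σ = [] := (List.append_eq_nil_iff.1 heq).1
      exact absurd (h4 ▸ h3) h0
    · have hσ : σ ∈ S := h1 σ (by simp)
      have hτ : τ ∈ S := h2 τ (by simp)
      simp only [List.flatten_cons] at heq
      have hστ : σ = τ := by
        rcases List.prefix_or_prefix_of_prefix (List.prefix_append σ L₁.flatten)
          (heq ▸ List.prefix_append τ L₂.flatten) with h5 | h5
        · exact h σ hσ τ hτ h5
        · exact (h τ hτ σ hσ h5).symm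
      subst hστ
      rw [ih L₂ (fun w hw => h1 w (by simp [hw])) (fun w hw => h2 w (by simp [hw]))
        (List.append_cancel_left heq)]

theorem sum_weight_le_one {T : Finset (List Bool)} (h0 : [] ∉ T)
    (h : ∀ σ ∈ T, ∀ τ ∈ T, σ <+: τ → σ = τ) : ∑ σ ∈ T, weight σ ≤ 1 := by
  have := InformationTheory.kraft_mcmillan_inequality (S := T)
    (uniquelyDecodable_of_prefixFree (by simpa using h0) (by simpa using h))
  simpa [weight] using this

/-- The machine that halts exactly on the one-letter string `false`. -/
def singletonMachine (σ : List Bool) : Part (List Bool) :=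
  bif decide (σ = [false]) then Part.some [] else Part.none

theorem singletonMachine_dom {σ : List Bool} : (singletonMachine σ).Dom ↔ σ = [false] := by
  unfold singletonMachine
  by_cases h : σ = [false] <;> simp [h]

theorem isPrefixFreeMachine_singletonMachine : IsPrefixFreeMachine singletonMachine := by
  refine ⟨Partrec.cond (computable_eq Computable.id (Computable.const _))
    (Computable.const []).partrec Partrec.none, fun σ τ hσ hτ _ => ?_⟩
  rw [singletonMachine_dom] at hσ hτ
  rw [hσ, hτ]

/-- If `U` simulates under `ρ` a machine that halts only on `[false]`, then `ρ ++ [true]` is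
incomparable with every string in the domain. Adding it keeps the set prefix-free, so by Kraft's
inequality its weight is left unused. -/
theorem haltingProbability_lt_one {U : List Bool →. List Bool}
    (hU : IsUniversalPrefixFreeMachine U) {x : ℝ} (hx : IsHaltingProbability U x) : x < 1 := by
  classical
  obtain ⟨ρ, hρ⟩ := hU.2 _ isPrefixFreeMachine_singletonMachine
  have hdom : ∀ σ, (U (ρ ++ σ)).Dom ↔ σ = [false] := fun σ => by
    rw [hρ, singletonMachine_dom]
  have hf : (U (ρ ++ [false])).Dom := (hdom _).2 rfl
  have h1 : ∀ σ, (U σ).Dom → ¬ (ρ ++ [true]) <+: σ := by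
    rintro _ hσ ⟨τ, rfl⟩
    rw [List.append_assoc, hdom] at hσ
    simp at hσ
  have h2 : ∀ σ, (U σ).Dom → ¬ σ <+: (ρ ++ [true]) := by
    intro σ hσ h
    rcases List.prefix_concat_iff.1 h with rfl | h
    · rw [hdom] at hσ
      simp at hσ
    · have h3 := hU.1.2 σ _ hσ hf (h.trans (List.prefix_append _ _))
      have h4 := h.length_le
      rw [h3] at h4
      simp at h4
  have hle : x ≤ 1 - weight (ρ ++ [true]) := by
    refine hasSum_le_of_sum_le hx fun T => ?_
    have hnot : ρ ++ [true] ∉ T.map (Function.Embedding.subtype _) := by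
      intro h
      rw [Finset.mem_map] at h
      obtain ⟨σ, _, hσ⟩ := h
      exact h1 σ σ.2 (by rw [← hσ]; exact List.prefix_rfl)
    have := sum_weight_le_one (T := insert (ρ ++ [true]) (T.map (Function.Embedding.subtype _)))
      ?_ ?_
    · rw [Finset.sum_insert hnot, Finset.sum_map] at this
      simp only [Function.Embedding.subtype_apply] at this
      change ∑ σ ∈ T, weight σ ≤ _
      linarith
    · simp only [Finset.mem_insert, Finset.mem_map, not_or, not_exists]
      refine ⟨by simp, ?_⟩
      rintro σ ⟨_, hσ⟩
      have h5 : (σ : List Bool) = [] := hσ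
      exact h2 σ σ.2 (by rw [h5]; exact List.nil_prefix)
    · intro σ hσ τ hτ h
      simp only [Finset.mem_insert, Finset.mem_map] at hσ hτ
      rcases hσ with rfl | ⟨σ, _, rfl⟩ <;> rcases hτ with rfl | ⟨τ, _, rfl⟩
      · rfl
      · exact absurd h (h1 τ τ.2)
      · exact absurd h (h2 σ σ.2)
      · exact hU.1.2 _ _ σ.2 τ.2 h
  have : 0 < weight (ρ ++ [true]) := by unfold weight; positivity
  linarith

theorem IsHaltingProbability.nonneg {M : List Bool →. List Bool} {x : ℝ}
    (hx : IsHaltingProbability M x) : 0 ≤ x := HasSum.nonneg (fun _ => by positivity) hx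

/-! ### Adding a small real approximated from below to an omega number. -/

/-- The running maximum of the dyadic rationals `r s / 2 ^ s`, `s ≥ 1`. -/
def runningMax (r : ℕ → ℕ) (s : ℕ) : ℕ :=
  Nat.rec 0 (fun i y => max (2 * y) (r (i + 1))) s

theorem runningMax_succ (r : ℕ → ℕ) (s : ℕ) :
    runningMax r (s + 1) = max (2 * runningMax r s) (r (s + 1)) := rfl

theorem computable_runningMax {r : ℕ → ℕ} (hr : Computable r) : Computable (runningMax r) := by
  have h : Computable₂ fun (_ : ℕ) (p : ℕ × ℕ) => max (2 * p.2) (r (p.1 + 1)) :=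
    computable_max (computable_mul (Computable.const 2) (Computable.snd.comp Computable.snd))
      (hr.comp (computable_add (Computable.fst.comp Computable.snd) (Computable.const 1)))
  exact Computable.nat_rec Computable.id (Computable.const 0) h

theorem ApproximatesFromBelow.runningMax_le {r : ℕ → ℕ} {x : ℝ} (h : ApproximatesFromBelow r x)
    (s : ℕ) : (runningMax r s : ℝ) / 2 ^ s ≤ x := by
  induction s with
  | zero =>
    have h0 := h.le 0
    refine le_trans ?_ h0
    simp [runningMax]
  | succ s ih =>
    have h1 := h.le (s + 1)
    rw [div_le_iff₀ (by positivity)] at h1 ih ⊢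
    rw [runningMax_succ, Nat.cast_max]
    refine max_le ?_ h1
    rw [pow_succ]
    push_cast
    linarith

theorem ApproximatesFromBelow.tendsto_runningMax {r : ℕ → ℕ} {x : ℝ}
    (h : ApproximatesFromBelow r x) :
    Filter.Tendsto (fun s => (runningMax r s : ℝ) / 2 ^ s) Filter.atTop (nhds x) := by
  refine tendsto_of_tendsto_of_tendsto_of_le_of_le' h.tendsto tendsto_const_nhds ?_
    (Filter.Eventually.of_forall h.runningMax_le)
  filter_upwards [Filter.eventually_ge_atTop 1] with s hs
  obtain ⟨s, rfl⟩ := Nat.exists_eq_add_of_le' hs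
  gcongr
  rw [runningMax_succ]
  exact le_max_right _ _

theorem computable_cut {E : Type*} [Primcodable E] {a : E → ℕ → ℕ} (ha : Computable₂ a) :
    Computable₂ fun e τ => cut (a e) τ := by
  have hl : Computable fun p : E × List Bool => p.2.length :=
    Computable.list_length.comp Computable.snd
  have hn : Computable fun p : E × List Bool => num p.2 := computable_num.comp Computable.snd
  have h1 : Computable fun p : E × List Bool => 2 * a p.1 (p.2.length - 1) :=
    computable_mul (Computable.const 2)
      (ha.comp Computable.fst (computable_sub hl (Computable.const 1)))
  have h2 : Computable fun p : E × List Bool => a p.1 p.2.length := ha.comp Computable.fst hl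
  exact computable_and (computable_le h1 hn) (computable_lt hn h2)

/-- The machine that simulates `U` on the strings `true :: σ` and halts on `false :: τ` if
`τ` belongs to the given set. -/
def join (U : List Bool →. List Bool) (D : List Bool → Bool) : List Bool →. List Bool
  | [] => Part.none
  | true :: σ => U σ
  | false :: τ => bif D τ then Part.some [] else Part.none

theorem partrec_join {U : List Bool →. List Bool} (hU : Partrec U) {D : List Bool → Bool}
    (hD : Computable D) : Partrec (join U D) := by
  have ht : Computable fun x : List Bool => x.tail := Primrec.list_tail.to_comp
  have hh : Computable fun x : List Bool => x.head? := Primrec.list_head?.to_comp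
  have h3 : Partrec fun x : List Bool =>
      bif decide (x.head? = some false) && D x.tail then Part.some ([] : List Bool)
        else Part.none :=
    Partrec.cond (computable_and (computable_eq hh (Computable.const _)) (hD.comp ht))
      (Computable.const []).partrec Partrec.none
  have h : Partrec fun x : List Bool => bif decide (x.head? = some true) then U x.tail else
      bif decide (x.head? = some false) && D x.tail then Part.some [] else Part.none :=
    Partrec.cond (computable_eq hh (Computable.const _)) (hU.comp ht) h3
  refine h.of_eq fun x => ?_
  match x with
  | [] => rfl
  | true :: σ => rfl
  | false :: τ => simp [join]

theorem join_false_dom {U : List Bool →. List Bool} {D : List Bool → Bool} {τ : List Bool} :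
    (join U D (false :: τ)).Dom ↔ D τ = true := by
  cases h : D τ <;> simp [join, h]

theorem isUniversal_join {U : List Bool →. List Bool} (hU : IsUniversalPrefixFreeMachine U)
    {D : List Bool → Bool} (hD : Computable D)
    (hpf : ∀ σ τ, D σ = true → D τ = true → σ <+: τ → σ = τ) :
    IsUniversalPrefixFreeMachine (join U D) := by
  refine ⟨⟨partrec_join hU.1.1 hD, fun σ τ hσ hτ h => ?_⟩, fun M hM => ?_⟩
  · match σ, τ with
    | [], _ => exact absurd hσ (by simp [join])
    | _ :: _, [] => simp at h
    | b :: σ, b' :: τ =>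
      obtain ⟨rfl, h'⟩ := List.cons_prefix_cons.1 h
      cases b
      · rw [join_false_dom] at hσ hτ
        rw [hpf σ τ hσ hτ h']
      · rw [hU.1.2 σ τ hσ hτ h']
  · obtain ⟨ρ, hρ⟩ := hU.2 M hM
    exact ⟨true :: ρ, hρ⟩

theorem isHaltingProbability_join {U : List Bool →. List Bool} {x : ℝ}
    (hU : IsHaltingProbability U x) {D : List Bool → Bool} {y : ℝ}
    (hD : HasSum (Set.indicator {τ | D τ = true} weight) y) :
    IsHaltingProbability (join U D) ((x + y) / 2) := by
  rw [isHaltingProbability_iff] at hU ⊢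
  have h1 := (hasSum_extend_zero (g := List.cons true) List.cons_injective).2 (hU.mul_left (1 / 2))
  have h2 := (hasSum_extend_zero (g := List.cons false) List.cons_injective).2
    (hD.mul_left (1 / 2))
  have h := h1.add h2
  rw [← mul_add, one_div_mul_eq_div] at h
  refine (congrArg (fun f => HasSum f ((x + y) / 2)) (funext fun σ => ?_)).mpr h
  have hw : ∀ b τ, weight (b :: τ) = 1 / 2 * weight τ := fun b τ => by
    simp [weight, pow_succ']
  have hne : ∀ (b : Bool) (f : List Bool → ℝ) (σ : List Bool), (∀ τ, b :: τ ≠ σ) →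
      Function.extend (List.cons b) f 0 σ = 0 := fun b f σ h =>
    Function.extend_apply' _ _ _ fun ⟨τ, hτ⟩ => h τ hτ
  match σ with
  | [] =>
    rw [hne _ _ _ (by simp), hne _ _ _ (by simp), Set.indicator_of_notMem (by simp [join]),
      add_zero]
  | true :: σ =>
    rw [List.cons_injective.extend_apply, hne _ _ _ (by simp), add_zero]
    by_cases hσ : (U σ).Dom
    · rw [Set.indicator_of_mem (by exact hσ), Set.indicator_of_mem (by exact hσ), hw]
    · rw [Set.indicator_of_notMem (by exact hσ), Set.indicator_of_notMem (by exact hσ), mul_zero]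
  | false :: σ =>
    rw [List.cons_injective.extend_apply, hne _ _ _ (by simp), zero_add]
    by_cases hσ : D σ = true
    · rw [Set.indicator_of_mem (by exact join_false_dom.2 hσ),
        Set.indicator_of_mem (by exact hσ), hw]
    · rw [Set.indicator_of_notMem (by exact fun h => hσ (join_false_dom.1 h)),
        Set.indicator_of_notMem (by exact hσ), mul_zero]

/-- `join` averages, and `Ω + γ` is the mean of `Ω` and `Ω + 2γ`; the bound on `γ` makes room for a
prefix-free set of measure `Ω + 2γ`. -/
theorem isOmegaNumber_add {Ω γ : ℝ} (hΩ : IsOmegaNumber Ω) {b : ℕ → ℕ}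
    (hb : ApproximatesFromBelow b γ) (hγ : 2 * γ ≤ 1 - Ω) : IsOmegaNumber (Ω + γ) := by
  obtain ⟨U, hU, hx⟩ := hΩ
  obtain ⟨α, hα⟩ := exists_approximatesFromBelow hU.1.1 hx
  have hr : ApproximatesFromBelow (fun s => α s + 2 * b s) (Ω + 2 * γ) := by
    have heq : ∀ s, ((α s + 2 * b s : ℕ) : ℝ) / 2 ^ s
        = (α s : ℝ) / 2 ^ s + 2 * ((b s : ℝ) / 2 ^ s) := fun s => by push_cast; ring
    refine ⟨computable_add hα.computable (computable_mul (Computable.const 2) hb.computable),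
      fun s => ?_, ?_⟩
    · rw [heq]
      linarith [hα.le s, hb.le s]
    · simp only [heq]
      exact hα.tendsto.add (hb.tendsto.const_mul 2)
  -- The running maximum starts at `0` and is nondecreasing as a dyadic rational, which `cut` needs;
  -- the limit is unchanged.
  set a := runningMax fun s => α s + 2 * b s with ha
  have hac : Computable a := computable_runningMax hr.computable
  have ha2 : ∀ s, 2 * a s ≤ a (s + 1) := fun s => by
    rw [ha, runningMax_succ]
    exact le_max_left _ _
  have hle : ∀ s, a s ≤ 2 ^ s := fun s => by
    have h1 := (hr.runningMax_le s).trans (by linarith : Ω + 2 * γ ≤ 1)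
    rw [div_le_one (by positivity)] at h1
    exact_mod_cast h1
  have hD : Computable (cut a) := by
    have h : Computable₂ fun (_ : Unit) (s : ℕ) => a s := hac.comp Computable.snd
    have h2 := (computable_cut h).comp (Computable.const ()) (Computable.id (α := List Bool))
    exact h2
  refine ⟨join U (cut a), isUniversal_join hU hD fun σ τ => cut_prefixFree ha2, ?_⟩
  have := isHaltingProbability_join hx (hasSum_cut rfl ha2 hle hr.tendsto_runningMax)
  convert this using 1
  ring

/-! ### Pushing a limit out of enumerated intervals. -/

section Pushing

variable (α : ℕ → ℕ) (K ℓ : ℕ) (Q : ℕ → ℕ → Bool)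

/-- At stage `s`, the dyadic rational `y / 2 ^ (s + K)` lies in, or immediately to the left of,
an interval of length `2 ^ (-ℓ)` that has been enumerated in `Q`. -/
def threatened (s y : ℕ) : Bool :=
  decide (ℓ ≤ s) && (Q (y / 2 ^ (s + K - ℓ)) s || Q (y / 2 ^ (s + K - ℓ) + 1) s)

/-- The sequence that pushes `α s / 2 ^ s + 2 ^ (-K) * (pushed s / 2 ^ s)` out of the intervals
enumerated in `Q`. -/
def pushed (s : ℕ) : ℕ :=
  Nat.rec 0 (fun s a => 2 * a +
    if threatened K ℓ Q s (2 ^ K * α s + a) = true then 2 ^ (s + K + 2 - ℓ) else 0) s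

theorem pushed_succ (s : ℕ) : pushed α K ℓ Q (s + 1) = 2 * pushed α K ℓ Q s +
    if threatened K ℓ Q s (2 ^ K * α s + pushed α K ℓ Q s) = true then 2 ^ (s + K + 2 - ℓ)
    else 0 := rfl

/-- The stages before `s` at which a payment is made. -/
def payments (s : ℕ) : Finset ℕ :=
  (Finset.range s).filter fun r => threatened K ℓ Q r (2 ^ K * α r + pushed α K ℓ Q r) = true

theorem two_mul_pushed_le (s : ℕ) : 2 * pushed α K ℓ Q s ≤ pushed α K ℓ Q (s + 1) := by
  rw [pushed_succ]; exact Nat.le_add_right _ _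

/-- Every payment contributes the same amount `2^(K + 1 - ℓ)` to the real `pushed s / 2^s`, whatever
its stage. -/
theorem pushed_mul (s : ℕ) :
    pushed α K ℓ Q s * 2 ^ ℓ = (payments α K ℓ Q s).card * 2 ^ (s + K + 1) := by
  induction s with
  | zero => rw [payments, Finset.range_zero, Finset.filter_empty]; simp [pushed]
  | succ s ih =>
    unfold payments at ih ⊢
    rw [pushed_succ, Finset.range_add_one, Finset.filter_insert]
    split_ifs with h
    · rw [Finset.card_insert_of_notMem (by simp), add_mul, add_mul, mul_assoc, ih, ← pow_add]
      -- A threat requires `ℓ ≤ s`, so the truncated subtraction in the exponent is exact.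
      have hℓ : ℓ ≤ s := by
        simp only [threatened, Bool.and_eq_true, decide_eq_true_eq] at h
        exact h.1
      have h1 : s + K + 2 - ℓ + ℓ = s + 1 + K + 1 := by omega
      have h2 : s + 1 + K + 1 = (s + K + 1) + 1 := by omega
      rw [h1, h2, pow_succ]
      ring
    · have h2 : s + 1 + K + 1 = (s + K + 1) + 1 := by omega
      rw [add_zero, mul_assoc, ih, h2, pow_succ]
      ring

variable {α K ℓ Q}

/-- After scaling by `2^(-K)` a payment is worth two intervals of length `2^(-ℓ)`, so it carries the
value past its own interval and past the next one; nothing later moves it back. -/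
theorem add_two_le_of_threatened (hα : ∀ s, 2 * α s ≤ α (s + 1)) {r r' : ℕ} (hr : r < r')
    (h : threatened K ℓ Q r (2 ^ K * α r + pushed α K ℓ Q r) = true) :
    (2 ^ K * α r + pushed α K ℓ Q r) / 2 ^ (r + K - ℓ) + 2 ≤
      (2 ^ K * α r' + pushed α K ℓ Q r') / 2 ^ (r' + K - ℓ) := by
  have hℓ : ℓ ≤ r := by
    simp only [threatened, Bool.and_eq_true, decide_eq_true_eq] at h
    exact h.1
  set y : ℕ → ℕ := fun s => 2 ^ K * α s + pushed α K ℓ Q s with hy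
  have hy2 : ∀ s, 2 * y s ≤ y (s + 1) := fun s => by
    have h1 := Nat.mul_le_mul_left (2 ^ K) (hα s)
    have h2 := two_mul_pushed_le α K ℓ Q s
    simp only [hy]
    linarith
  have h1 : 2 * (y r + 2 * 2 ^ (r + K - ℓ)) ≤ y (r + 1) := by
    have h1 := Nat.mul_le_mul_left (2 ^ K) (hα r)
    have h3 : r + K + 2 - ℓ = (r + K - ℓ) + 2 := by omega
    simp only [hy]
    rw [pushed_succ, if_pos h, h3, pow_add]
    linarith
  obtain ⟨k, rfl⟩ : ∃ k, r' = r + 1 + k := Nat.exists_eq_add_of_le hr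
  have h2 := two_pow_mul_le hy2 (r + 1) k
  change y r / _ + 2 ≤ y (r + 1 + k) / _
  have h4 : r + 1 + k + K - ℓ = (r + K - ℓ) + (k + 1) := by omega
  rw [Nat.le_div_iff_mul_le (by positivity), h4, pow_add, pow_succ]
  have h5 : (y r / 2 ^ (r + K - ℓ) + 2) * 2 ^ (r + K - ℓ) ≤ y r + 2 * 2 ^ (r + K - ℓ) := by
    rw [add_mul]
    exact Nat.add_le_add_right (Nat.div_mul_le_self _ _) _
  calc (y r / 2 ^ (r + K - ℓ) + 2) * (2 ^ (r + K - ℓ) * (2 ^ k * 2))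
      = 2 ^ k * (2 * ((y r / 2 ^ (r + K - ℓ) + 2) * 2 ^ (r + K - ℓ))) := by ring
    _ ≤ 2 ^ k * (2 * (y r + 2 * 2 ^ (r + K - ℓ))) := by gcongr
    _ ≤ 2 ^ k * y (r + 1) := by gcongr
    _ ≤ _ := h2

/-- Charge each payment to the interval that caused it, with index `m₀ r` or `m₀ r + 1`. Positions
at different payments are at least two intervals apart, so no interval is charged twice. -/
theorem card_payments_le (hα : ∀ s, 2 * α s ≤ α (s + 1)) {C : Finset ℕ}
    (hC : ∀ m s, Q m s = true → m ∈ C) (s : ℕ) : (payments α K ℓ Q s).card ≤ C.card := by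
  set m₀ : ℕ → ℕ := fun r => (2 ^ K * α r + pushed α K ℓ Q r) / 2 ^ (r + K - ℓ) with hm₀
  refine Finset.card_le_card_of_injOn
    (fun r => if Q (m₀ r) r = true then m₀ r else m₀ r + 1) ?_ ?_
  · intro r hr
    simp only [payments, Finset.coe_filter, Set.mem_ofPred_eq, threatened, Bool.and_eq_true,
      Bool.or_eq_true] at hr
    simp only [Finset.mem_coe]
    split_ifs with h
    · exact hC _ _ h
    · exact hC _ _ (hr.2.2.resolve_left h)
  · have key : ∀ r r', r ∈ payments α K ℓ Q s → r < r' →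
        (if Q (m₀ r) r = true then m₀ r else m₀ r + 1) ≠
          (if Q (m₀ r') r' = true then m₀ r' else m₀ r' + 1) := by
      intro r r' hr hlt
      simp only [payments, Finset.mem_filter] at hr
      have : m₀ r + 2 ≤ m₀ r' := add_two_le_of_threatened hα hlt hr.2
      split_ifs <;> omega
    intro r hr r' hr' h
    rcases lt_trichotomy r r' with hlt | heq | hlt
    · exact absurd h (key r r' hr hlt)
    · exact heq
    · exact absurd h.symm (key r' r hr' hlt)

/-- At most `C.card` payments of size `2^(K + 1 - ℓ)` total at most `1`; hence the pushed amount
fits into a prefix-free set. -/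
theorem pushed_le (hα : ∀ s, 2 * α s ≤ α (s + 1)) {C : Finset ℕ}
    (hC : ∀ m s, Q m s = true → m ∈ C) (hcard : C.card * 2 ^ (K + 1) ≤ 2 ^ ℓ) (s : ℕ) :
    pushed α K ℓ Q s ≤ 2 ^ s := by
  refine Nat.le_of_mul_le_mul_right ?_ (show 0 < 2 ^ ℓ by positivity)
  rw [pushed_mul, add_assoc, pow_add]
  calc _ ≤ C.card * (2 ^ s * 2 ^ (K + 1)) := Nat.mul_le_mul_right _ (card_payments_le hα hC s)
    _ = 2 ^ s * (C.card * 2 ^ (K + 1)) := by ring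
    _ ≤ _ := by gcongr

/-- A sequence that pays for every threat cannot have its limit in an enumerated interval. -/
theorem not_enumerated_of_tendsto (hα : ∀ s, 2 * α s ≤ α (s + 1))
    (hQ : ∀ m s s', s ≤ s' → Q m s = true → Q m s' = true) {x : ℝ}
    (hle : ∀ s, ((2 ^ K * α s + pushed α K ℓ Q s : ℕ) : ℝ) / 2 ^ (s + K) ≤ x)
    (hlim : Filter.Tendsto (fun s => ((2 ^ K * α s + pushed α K ℓ Q s : ℕ) : ℝ) / 2 ^ (s + K))
      Filter.atTop (nhds x)) (hx : 0 ≤ x) (s₀ : ℕ) : Q ⌊(2 : ℝ) ^ ℓ * x⌋₊ s₀ = false := by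
  by_contra hs₀
  rw [Bool.not_eq_false] at hs₀
  set y : ℕ → ℕ := fun s => 2 ^ K * α s + pushed α K ℓ Q s with hy
  set m := ⌊(2 : ℝ) ^ ℓ * x⌋₊ with hm
  have hmle : (m : ℝ) ≤ 2 ^ ℓ * x := Nat.floor_le (by positivity)
  have hmlt : 2 ^ ℓ * x < m + 1 := Nat.lt_floor_add_one _
  have h1 := hlim.const_mul ((2 : ℝ) ^ ℓ)
  have h2 := h1.eventually (lt_mem_nhds (show (m : ℝ) - 1 < 2 ^ ℓ * x by linarith))
  -- At this stage interval `m` is already enumerated and the value is beyond the left end of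
  -- interval `m - 1`. The limit may be the left end of interval `m` itself, which is why
  -- `threatened` also looks one interval to the right.
  obtain ⟨s, hs1, hs2, hs3⟩ := (h2.and ((Filter.eventually_ge_atTop s₀).and
    (Filter.eventually_ge_atTop ℓ))).exists
  have hfl : y s / 2 ^ (s + K - ℓ) = ⌊(2 : ℝ) ^ ℓ * ((y s : ℝ) / 2 ^ (s + K))⌋₊ := by
    rw [← Nat.floor_div_eq_div (K := ℝ)]
    congr 1
    push_cast
    rw [pow_sub₀ (2 : ℝ) two_ne_zero (by omega)]
    field_simp
  have hlow : m ≤ y s / 2 ^ (s + K - ℓ) + 1 := by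
    rw [hfl]
    have := Nat.lt_floor_add_one ((2 : ℝ) ^ ℓ * ((y s : ℝ) / 2 ^ (s + K)))
    have h3 : (m : ℝ) < (⌊(2 : ℝ) ^ ℓ * ((y s : ℝ) / 2 ^ (s + K))⌋₊ : ℝ) + 1 + 1 := by linarith
    have h4 : m < ⌊(2 : ℝ) ^ ℓ * ((y s : ℝ) / 2 ^ (s + K))⌋₊ + 1 + 1 := by exact_mod_cast h3
    omega
  have hup : ∀ r, y r / 2 ^ (r + K - ℓ) ≤ m ∨ r + K < ℓ := by
    intro r
    by_cases hr : r + K < ℓ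
    · exact Or.inr hr
    · left
      rw [← Nat.floor_div_eq_div (K := ℝ)]
      refine Nat.floor_le_floor ?_
      push_cast
      rw [pow_sub₀ (2 : ℝ) two_ne_zero (by omega)]
      calc _ = (2 : ℝ) ^ ℓ * ((y r : ℝ) / 2 ^ (r + K)) := by field_simp
        _ ≤ _ := by gcongr; exact hle r
  have hthr : threatened K ℓ Q s (y s) = true := by
    simp only [threatened, Bool.and_eq_true, decide_eq_true_eq, Bool.or_eq_true]
    refine ⟨hs3, ?_⟩
    have hup' := (hup s).resolve_right (by omega)
    rcases Nat.lt_or_ge (y s / 2 ^ (s + K - ℓ)) m with h | h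
    · right
      rw [show y s / 2 ^ (s + K - ℓ) + 1 = m by omega]
      exact hQ m s₀ s hs2 hs₀
    · left
      rw [show y s / 2 ^ (s + K - ℓ) = m by omega]
      exact hQ m s₀ s hs2 hs₀
  -- The payment lifts the index from at least `m - 1` to more than `m`, although all values stay at
  -- or below `x`.
  have h5 := add_two_le_of_threatened hα (Nat.lt_succ_self s) hthr
  have h6 := (hup (s + 1)).resolve_right (by omega)
  change y s / 2 ^ (s + K - ℓ) + 2 ≤ y (s + 1) / 2 ^ (s + 1 + K - ℓ) at h5
  omega

end Pushing

/-! ### Self-reference and the randomness of omega numbers. -/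

/-- The self-delimiting code `1 ^ e 0` of a natural number. -/
def unary (e : ℕ) : List Bool := (List.range e).map (fun _ => true) ++ [false]

/-- The `e`-th string, followed by the code of `e`. -/
def guess (e : ℕ) : List Bool := ((Encodable.decode (α := List Bool) e).getD []) ++ unary e

theorem unary_eq (e : ℕ) : unary e = List.replicate e true ++ [false] := by
  simp [unary, List.map_const']

theorem unary_succ (e : ℕ) : unary (e + 1) = true :: unary e := by
  simp [unary_eq, List.replicate_succ]

theorem length_unary (e : ℕ) : (unary e).length = e + 1 := by simp [unary]

theorem computable_guess : Computable guess := by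
  have h1 : Primrec fun e : ℕ => (Encodable.decode (α := List Bool) e).getD [] :=
    Primrec.option_getD.comp Primrec.decode (Primrec.const [])
  have h2 : Primrec unary := by
    have h3 : Primrec₂ fun (_ : ℕ) (_ : ℕ) => true := Primrec.const true
    exact Primrec.list_append.comp (Primrec.list_map Primrec.list_range h3)
      (Primrec.const [false])
  exact (Primrec.list_append.comp h1 h2).to_comp

theorem unary_append_prefix {e e' : ℕ} {σ τ : List Bool}
    (h : unary e ++ σ <+: unary e' ++ τ) : e = e' ∧ σ <+: τ := by
  induction e generalizing e' with
  | zero =>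
    cases e' with
    | zero => simpa [unary_eq] using h
    | succ e' => simp [unary_eq, List.replicate_succ] at h
  | succ e ih =>
    cases e' with
    | zero => simp [unary_eq, List.replicate_succ] at h
    | succ e' =>
      rw [unary_succ, unary_succ, List.cons_append, List.cons_append,
        List.cons_prefix_cons] at h
      obtain ⟨rfl, h'⟩ := ih h.2
      exact ⟨rfl, h'⟩

/-- The machine that halts exactly on the strings `1 ^ e 0 τ` with `τ` in the `e`-th cut. -/
def familyMachine (a : ℕ → ℕ → ℕ) (x : List Bool) : Part (List Bool) :=
  bif decide ((x.takeWhile id).length < x.length) &&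
      cut (a (x.takeWhile id).length) (x.drop ((x.takeWhile id).length + 1)) then
    Part.some [] else Part.none

theorem takeWhile_unary_append (e : ℕ) (τ : List Bool) :
    ((unary e ++ τ).takeWhile id).length = e := by
  induction e with
  | zero => simp [unary]
  | succ e ih => rw [unary_succ, List.cons_append]; simp [ih]

theorem eq_unary_append_of_takeWhile {x : List Bool} (h : (x.takeWhile id).length < x.length) :
    x = unary (x.takeWhile id).length ++ x.drop ((x.takeWhile id).length + 1) := by
  induction x with
  | nil => simp at h
  | cons b x ih =>
    cases b
    · simp [unary]
    · simp only [List.takeWhile_cons, id_eq, if_true, List.length_cons, List.drop_succ_cons] at h ⊢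
      rw [unary_succ, List.cons_append]
      congr 1
      exact ih (by omega)

theorem familyMachine_unary_dom {a : ℕ → ℕ → ℕ} {e : ℕ} {τ : List Bool} :
    (familyMachine a (unary e ++ τ)).Dom ↔ cut (a e) τ = true := by
  unfold familyMachine
  have h1 : (unary e ++ τ).drop (e + 1) = τ := by
    rw [← length_unary e, List.drop_left]
  have h2 : e < (unary e ++ τ).length := by
    rw [List.length_append, length_unary]; omega
  rw [takeWhile_unary_append, h1, decide_eq_true h2, Bool.true_and]
  cases h : cut (a e) τ <;> simp

theorem exists_of_familyMachine_dom {a : ℕ → ℕ → ℕ} {x : List Bool}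
    (h : (familyMachine a x).Dom) : ∃ e τ, x = unary e ++ τ := by
  unfold familyMachine at h
  by_cases hx : (x.takeWhile id).length < x.length
  · exact ⟨_, _, eq_unary_append_of_takeWhile hx⟩
  · simp only [hx, decide_false, Bool.false_and, cond_false] at h
    exact h.elim

theorem isPrefixFreeMachine_familyMachine {a : ℕ → ℕ → ℕ} (hc : Computable₂ a)
    (ha : ∀ e s, 2 * a e s ≤ a e (s + 1)) : IsPrefixFreeMachine (familyMachine a) := by
  constructor
  · have ht : Computable fun x : List Bool => (x.takeWhile id).length :=
      Computable.list_length.comp (Primrec.list_takeWhile Primrec.id).to_comp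
    have hd : Computable fun x : List Bool => x.drop ((x.takeWhile id).length + 1) :=
      Primrec.list_drop.to_comp.comp (Computable.succ.comp ht) Computable.id
    have h1 : Computable fun x : List Bool => decide ((x.takeWhile id).length < x.length) :=
      computable_lt ht Computable.list_length
    have h2 : Computable fun x : List Bool =>
        cut (a (x.takeWhile id).length) (x.drop ((x.takeWhile id).length + 1)) :=
      (computable_cut hc).comp ht hd
    exact Partrec.cond (computable_and h1 h2) (Computable.const []).partrec Partrec.none
  · intro σ τ hσ hτ h
    obtain ⟨e, σ, rfl⟩ := exists_of_familyMachine_dom hσ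
    obtain ⟨e', τ, rfl⟩ := exists_of_familyMachine_dom hτ
    obtain ⟨rfl, h'⟩ := unary_append_prefix h
    rw [familyMachine_unary_dom] at hσ hτ
    rw [cut_prefixFree (ha e) hσ hτ h']

theorem computable_pushed {α : ℕ → ℕ → ℕ} {K ℓ : ℕ → ℕ} {Q : ℕ → ℕ → ℕ → Bool}
    (hα : Computable₂ α) (hK : Computable K) (hℓ : Computable ℓ)
    (hQ : Computable fun p : ℕ × ℕ × ℕ => Q p.1 p.2.1 p.2.2) :
    Computable₂ fun e s => pushed (α e) (K e) (ℓ e) (Q e) s := by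
  have he : Computable fun q : (ℕ × ℕ) × ℕ × ℕ => q.1.1 := Computable.fst.comp Computable.fst
  have hs : Computable fun q : (ℕ × ℕ) × ℕ × ℕ => q.2.1 := Computable.fst.comp Computable.snd
  have ha : Computable fun q : (ℕ × ℕ) × ℕ × ℕ => q.2.2 := Computable.snd.comp Computable.snd
  have hKe : Computable fun q : (ℕ × ℕ) × ℕ × ℕ => K q.1.1 := hK.comp he
  have hℓe : Computable fun q : (ℕ × ℕ) × ℕ × ℕ => ℓ q.1.1 := hℓ.comp he
  have hy : Computable fun q : (ℕ × ℕ) × ℕ × ℕ => 2 ^ K q.1.1 * α q.1.1 q.2.1 + q.2.2 :=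
    computable_add (computable_mul (computable_two_pow hKe) (hα.comp he hs)) ha
  have hd : Computable fun q : (ℕ × ℕ) × ℕ × ℕ =>
      (2 ^ K q.1.1 * α q.1.1 q.2.1 + q.2.2) / 2 ^ (q.2.1 + K q.1.1 - ℓ q.1.1) :=
    computable_div hy (computable_two_pow (computable_sub (computable_add hs hKe) hℓe))
  have ht : Computable fun q : (ℕ × ℕ) × ℕ × ℕ => threatened (K q.1.1) (ℓ q.1.1) (Q q.1.1) q.2.1
      (2 ^ K q.1.1 * α q.1.1 q.2.1 + q.2.2) :=
    computable_and (computable_le hℓe hs) (computable_or (computable₃_comp hQ he hd hs)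
      (computable₃_comp hQ he (Computable.succ.comp hd) hs))
  have hstep : Computable₂ fun (p : ℕ × ℕ) (q : ℕ × ℕ) => 2 * q.2 +
      if threatened (K p.1) (ℓ p.1) (Q p.1) q.1 (2 ^ K p.1 * α p.1 q.1 + q.2) = true
      then 2 ^ (q.1 + K p.1 + 2 - ℓ p.1) else 0 :=
    computable_add (computable_mul (Computable.const 2) ha)
      (computable_ite ht (computable_two_pow (computable_sub
        (computable_add (computable_add hs hKe) (Computable.const 2)) hℓe)) (Computable.const 0))
  exact Computable.nat_rec Computable.snd (Computable.const 0) hstep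

/-- Omega numbers avoid some member of every uniformly computably enumerable sequence of sets of
dyadic intervals whose measures tend to `0` effectively. -/
theorem exists_not_enumerated {Ω : ℝ} (hΩ : IsOmegaNumber Ω) {L : ℕ → ℕ} (hL : Computable L)
    {P : ℕ → ℕ → ℕ → Bool} (hP : Computable fun p : ℕ × ℕ × ℕ => P p.1 p.2.1 p.2.2)
    (hmono : ∀ k m s s', s ≤ s' → P k m s = true → P k m s' = true)
    (hbound : ∀ k, ∃ C : Finset ℕ, (∀ m s, P k m s = true → m ∈ C) ∧
      C.card * 2 ^ (k + 1) ≤ 2 ^ L k) :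
    ∃ k, ∀ s, P k ⌊(2 : ℝ) ^ L k * Ω⌋₊ s = false := by
  obtain ⟨U, hU, hx⟩ := hΩ
  obtain ⟨F, hF, hFmono, hFdom⟩ := exists_enumeration hU.1.1
  -- The part of the domain of `U` outside the cone above `guess e`. What is put inside that cone
  -- can react to it without circularity.
  set G : ℕ → ℕ → List Bool → Bool := fun e s σ =>
    F s σ && !decide (σ.take (guess e).length = guess e) with hG
  have hGc : Computable fun p : ℕ × ℕ × List Bool => G p.1 p.2.1 p.2.2 := by
    have hg : Computable fun p : ℕ × ℕ × List Bool => guess p.1 :=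
      computable_guess.comp Computable.fst
    have hσ : Computable fun p : ℕ × ℕ × List Bool => p.2.2 :=
      Computable.snd.comp Computable.snd
    have ht : Computable fun p : ℕ × ℕ × List Bool => p.2.2.take (guess p.1).length :=
      Primrec.list_take.to_comp.comp (Computable.list_length.comp hg) hσ
    exact computable_and (hF.comp (Computable.fst.comp Computable.snd) hσ)
      (computable_not (computable_eq ht hg))
  have hGmono : ∀ e s s' σ, s ≤ s' → G e s σ = true → G e s' σ = true := by
    intro e s s' σ hs h
    simp only [hG, Bool.and_eq_true] at h ⊢
    exact ⟨hFmono s s' σ hs h.1, h.2⟩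
  set α : ℕ → ℕ → ℕ := fun e s => stageMeasure (G e) s with hα
  have hα2 : ∀ e s, 2 * α e s ≤ α e (s + 1) := fun e s => two_mul_stageMeasure_le (hGmono e) s
  set K : ℕ → ℕ := fun e => (guess e).length with hK
  have hKc : Computable K := Computable.list_length.comp computable_guess
  set a : ℕ → ℕ → ℕ := fun e s => pushed (α e) (K e) (L (K e)) (P (K e)) s with ha
  have hPK : Computable fun p : ℕ × ℕ × ℕ => P (K p.1) p.2.1 p.2.2 :=
    computable₃_comp hP (hKc.comp Computable.fst) (Computable.fst.comp Computable.snd)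
      (Computable.snd.comp Computable.snd)
  have hac : Computable₂ a :=
    computable_pushed (Q := fun e => P (K e)) (computable_stageMeasure hGc) hKc (hL.comp hKc) hPK
  have ha2 : ∀ e s, 2 * a e s ≤ a e (s + 1) := fun e s => two_mul_pushed_le _ _ _ _ s
  have hale : ∀ e s, a e s ≤ 2 ^ s := fun e s => by
    obtain ⟨C, hC, hcard⟩ := hbound (K e)
    exact pushed_le (hα2 e) hC hcard s
  -- This replaces the recursion theorem: index `e` acts on the guess that the coding prefix is the
  -- string with code `e`, and `e = encode ρ` guesses correctly. For it, `guess e` is exactly the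
  -- prefix under which `U` runs the `e`-th cut.
  obtain ⟨ρ, hρ⟩ := hU.2 _ (isPrefixFreeMachine_familyMachine hac ha2)
  set e := Encodable.encode ρ with he
  have hguess : guess e = ρ ++ unary e := by simp [guess, he]
  have hdom : ∀ τ, (U (guess e ++ τ)).Dom ↔ cut (a e) τ = true := fun τ => by
    rw [hguess, List.append_assoc, hρ, familyMachine_unary_dom]
  have hmonoA : Monotone fun s => (a e s : ℝ) / 2 ^ s := by
    refine monotone_nat_of_le_succ fun s => ?_
    rw [div_le_div_iff₀ (by positivity) (by positivity), pow_succ]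
    have : (2 : ℝ) * a e s ≤ a e (s + 1) := by exact_mod_cast ha2 e s
    nlinarith [pow_pos (two_pos : (0 : ℝ) < 2) s]
  have hbdd : BddAbove (Set.range fun s => (a e s : ℝ) / 2 ^ s) := by
    refine ⟨1, ?_⟩
    rintro _ ⟨s, rfl⟩
    rw [div_le_one (by positivity)]
    exact_mod_cast hale e s
  have hlim := tendsto_atTop_ciSup hmonoA hbdd
  set ν := ⨆ s, (a e s : ℝ) / 2 ^ s
  have hν := hasSum_cut rfl (ha2 e) (hale e) hlim
  have hxi := hx
  rw [isHaltingProbability_iff] at hxi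
  have hin := (hasSum_extend_zero (g := fun τ => guess e ++ τ)
    (List.append_right_injective _)).2 (hν.mul_left (weight (guess e)))
  have hout := hxi.sub hin
  have heq : (fun σ => Set.indicator {σ | (U σ).Dom} weight σ -
      Function.extend (fun τ => guess e ++ τ)
        (fun τ => weight (guess e) * Set.indicator {τ | cut (a e) τ = true} weight τ) 0 σ) =
      Set.indicator {σ | ∃ s, G e s σ = true} weight := by
    funext σ
    by_cases hp : guess e <+: σ
    · obtain ⟨τ, rfl⟩ := hp
      have h1 : guess e ++ τ ∉ {σ | ∃ s, G e s σ = true} := by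
        rintro ⟨s, hs⟩
        simp [hG] at hs
      rw [Set.indicator_of_notMem h1,
        (List.append_right_injective (guess e)).extend_apply (f := fun τ => guess e ++ τ)]
      by_cases hτ : cut (a e) τ = true
      · rw [Set.indicator_of_mem (by exact (hdom τ).2 hτ), Set.indicator_of_mem (by exact hτ),
          weight_append, sub_self]
      · rw [Set.indicator_of_notMem (by exact fun h => hτ ((hdom τ).1 h)),
          Set.indicator_of_notMem (by exact hτ), mul_zero, sub_self]
    · have h1 : ¬ ∃ τ, guess e ++ τ = σ := hp
      rw [Function.extend_apply' _ _ _ h1, Pi.zero_apply, sub_zero]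
      have h2 : ¬ σ.take (guess e).length = guess e := fun h =>
        hp (h ▸ List.take_prefix _ _)
      have h3 : (∃ s, G e s σ = true) ↔ (U σ).Dom := by
        rw [← hFdom]
        simp [hG, h2]
      by_cases hσ : (U σ).Dom
      · rw [Set.indicator_of_mem (by exact hσ), Set.indicator_of_mem (by exact h3.2 hσ)]
      · rw [Set.indicator_of_notMem (by exact hσ),
          Set.indicator_of_notMem (by exact fun h => hσ (h3.1 h))]
  rw [heq] at hout
  -- The value being pushed is the approximation to `Ω` itself: the measure outside the cone plus
  -- the share of the cone, scaled by `2^(-K e)`.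
  have hy : ∀ s, ((2 ^ K e * α e s + a e s : ℕ) : ℝ) / 2 ^ (s + K e) =
      (α e s : ℝ) / 2 ^ s + weight (guess e) * ((a e s : ℝ) / 2 ^ s) := by
    intro s
    have hw : weight (guess e) = 1 / 2 ^ K e := by rw [weight, one_div, inv_pow, one_div]
    rw [hw, pow_add]
    push_cast
    field_simp
  refine ⟨K e, fun s₀ => not_enumerated_of_tendsto (K := K e) (hα2 e) (hmono (K e)) (fun s => ?_) ?_
    hx.nonneg s₀⟩
  · refine (hy s).trans_le ?_
    have h1 := stageMeasure_le hout s
    have h2 := mul_le_mul_of_nonneg_left (hmonoA.ge_of_tendsto hlim s) (weight_nonneg (guess e))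
    linarith
  · refine Filter.Tendsto.congr (fun s => (hy s).symm) ?_
    have h1 := (tendsto_stageMeasure (hGmono e) hout).add (hlim.const_mul (weight (guess e)))
    rwa [sub_add_cancel] at h1

/-! ### The carry test at a single level. -/

/-- The prediction `o` is compatible with a digit that equals `d` on the cells up to `e` and
differs from `d` on the cells from `e` on. -/
def compatible (o : Option Bool) (d : Bool) (e cell : ℕ) : Bool :=
  (decide (o = some d) && decide (cell ≤ e)) || (decide (o = some !d) && decide (e ≤ cell))

/-- The string with number `m` and length `w + 2` passes the test at a level `(n, w)`: unless its
digits at the positions `n + 1, …, w - 1` are all `1`, the predictions `S` of the `n`-th digit that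
are made from its prefixes of lengths `w` and `w - 1` are compatible with the carry into the `n`-th
position that results from adding `2 ^ (-w - 1)` or `2 ^ (-w)`. -/
def passes (S : List Bool → ℕ → Option Bool) (n w m : ℕ) : Bool :=
  (!decide ((m / 8 + 1) % 2 ^ (w - 1 - n) = 0)) ||
    (compatible (S (bits (m / 4) w) n) (decide (m / 2 ^ (w + 2 - n) % 2 = 1)) 5 (m % 8) ||
      compatible (S (bits (m / 8) (w - 1)) n) (decide (m / 2 ^ (w + 2 - n) % 2 = 1)) 3 (m % 8))

theorem compatible_eq_true_iff {o : Option Bool} {d : Bool} {e cell : ℕ} :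
    compatible o d e cell = true ↔ (o = some d ∧ cell ≤ e) ∨ (o = some (!d) ∧ e ≤ cell) := by
  simp [compatible]

/-- Above every string of length `n` some string of length `w + 2` fails the test. -/
theorem exists_not_passes {S : ℕ → List Bool → ℕ → Option Bool} {n w : ℕ} (hn : n + 1 ≤ w)
    (hS : ∀ s s' σ τ b b', σ <+: τ → S s σ n = some b → S s' τ n = some b' → b = b') (p : ℕ) :
    ∃ m, m / 2 ^ (w + 2 - n) = p ∧ ∀ s, passes (S s) n w m = false := by
  obtain ⟨k, rfl⟩ := Nat.exists_eq_add_of_le hn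
  -- The string `p` followed by `k` ones, so that a carry from the last three digits runs up to
  -- position `n`.
  set x₀ := (p + 1) * 2 ^ k - 1 with hx₀
  have hpos : 1 ≤ (p + 1) * 2 ^ k := Nat.one_le_iff_ne_zero.2 (by positivity)
  have hx₁ : x₀ + 1 = (p + 1) * 2 ^ k := by omega
  have hx₂ : x₀ / 2 ^ k = p := by
    rw [Nat.div_eq_iff (by positivity)]
    have : 0 < 2 ^ k := by positivity
    rw [add_mul, one_mul] at hx₁
    omega
  have hk : n + 1 + k + 2 - n = k + 3 := by omega
  have hk' : n + 1 + k - 1 - n = k := by omega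
  have hdiv : ∀ c < 8, (8 * x₀ + c) / 2 ^ (n + 1 + k + 2 - n) = p := by
    intro c hc
    rw [hk, pow_add, mul_comm (2 ^ k), ← Nat.div_div_eq_div_mul]
    rw [show (8 * x₀ + c) / 2 ^ 3 = x₀ by omega, hx₂]
  have hiff : ∀ c < 8, ∀ s, passes (S s) n (n + 1 + k) (8 * x₀ + c) = true ↔
      compatible (S s (bits (2 * x₀ + c / 4) (n + k + 1)) n) (decide (p % 2 = 1)) 5 c = true ∨
        compatible (S s (bits x₀ (n + k)) n) (decide (p % 2 = 1)) 3 c = true := by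
    intro c hc s
    unfold passes
    rw [hdiv c hc, show (8 * x₀ + c) / 8 = x₀ by omega, hk', hx₁, Nat.mul_mod_left,
      show (8 * x₀ + c) / 4 = 2 * x₀ + c / 4 by omega, show (8 * x₀ + c) % 8 = c by omega,
      show n + 1 + k = n + k + 1 by omega, Nat.add_sub_cancel]
    simp
  have hpre : ∀ e < 2, bits x₀ (n + k) <+: bits (2 * x₀ + e) (n + k + 1) := by
    intro e he
    have := bits_div_prefix (2 * x₀ + e) (n + k) 1
    rwa [pow_one, show (2 * x₀ + e) / 2 = x₀ by omega] at this
  set d := decide (p % 2 = 1)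
  suffices h : ∃ c < 8, ∀ s, ¬ (compatible (S s (bits (2 * x₀ + c / 4) (n + k + 1)) n) d 5 c = true ∨
        compatible (S s (bits x₀ (n + k)) n) d 3 c = true) by
    obtain ⟨c, hc, h⟩ := h
    refine ⟨8 * x₀ + c, hdiv c hc, fun s => ?_⟩
    rw [← Bool.not_eq_true, hiff c hc]
    exact h s
  simp only [compatible_eq_true_iff]
  -- Predicting `d` means no carry, and the last three digits `c = 7` refute it; predicting `!d`
  -- means a carry, and `c = 0` refutes it. By consistency the longer prefix cannot contradict a
  -- prediction made from the shorter one.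
  by_cases h₀ : ∃ s, S s (bits x₀ (n + k)) n = some d
  · obtain ⟨s₀, h₀⟩ := h₀
    refine ⟨7, by norm_num, fun s => ?_⟩
    rintro ((⟨_, h⟩ | ⟨h, _⟩) | (⟨_, h⟩ | ⟨h, _⟩))
    · omega
    · have := hS _ _ _ _ _ _ (hpre (7 / 4) (by norm_num)) h₀ h
      simp at this
    · omega
    · have := hS _ _ _ _ _ _ List.prefix_rfl h₀ h
      simp at this
  · by_cases h₁ : ∃ s, S s (bits x₀ (n + k)) n = some (!d)
    · obtain ⟨s₁, h₁⟩ := h₁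
      refine ⟨0, by norm_num, fun s => ?_⟩
      rintro ((⟨h, _⟩ | ⟨_, h⟩) | (⟨h, _⟩ | ⟨_, h⟩))
      · have := hS _ _ _ _ _ _ (hpre (0 / 4) (by norm_num)) h₁ h
        simp at this
      · omega
      · exact h₀ ⟨s, h⟩
      · omega
    · by_cases h₂ : ∃ s, S s (bits (2 * x₀ + 1) (n + k + 1)) n = some d
      · obtain ⟨s₂, h₂⟩ := h₂
        refine ⟨7, by norm_num, fun s => ?_⟩
        rintro ((⟨_, h⟩ | ⟨h, _⟩) | (⟨h, _⟩ | ⟨h, _⟩))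
        · omega
        · have := hS _ _ _ _ _ _ List.prefix_rfl h₂ h
          simp at this
        · exact h₀ ⟨s, h⟩
        · exact h₁ ⟨s, h⟩
      -- Only a carry predicted from the longer prefix `x₀1` remains possible. Cell `4` extends this
      -- prefix and lies below the threshold `5`.
      · refine ⟨4, by norm_num, fun s => ?_⟩
        rintro ((⟨h, _⟩ | ⟨_, h⟩) | (⟨h, _⟩ | ⟨h, _⟩))
        · exact h₂ ⟨s, h⟩
        · omega
        · exact h₀ ⟨s, h⟩
        · exact h₁ ⟨s, h⟩

/-! ### Counting the strings that pass several levels. -/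

section Counting

variable (r : ℕ → Bool) (n w : ℕ → ℕ) (lvl : ℕ → ℕ → Prop)

open Classical in
/-- The numbers of the strings of length `D` that pass all retained levels before `M`. -/
noncomputable def survivors (M D : ℕ) : Finset ℕ :=
  (Finset.range (2 ^ D)).filter fun m => ∀ j < M, r j = true → lvl j (m / 2 ^ (D - (w j + 2)))

variable {r n w lvl}

theorem card_fiber_le {T : Finset ℕ} {k x : ℕ} (h : ∀ m ∈ T, m / 2 ^ k = x) :
    T.card ≤ 2 ^ k := by
  have hsub : T ⊆ Finset.Ico (x * 2 ^ k) (x * 2 ^ k + 2 ^ k) := by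
    intro m hm
    have h1 := (Nat.div_eq_iff (by positivity)).1 (h m hm)
    have : 0 < 2 ^ k := by positivity
    rw [Finset.mem_Ico]
    omega
  simpa using Finset.card_le_card hsub

/-- By `hsep` the earlier levels read only the first `n M` digits, so truncating a survivor to
length `n M` gives a survivor of those levels. Of its `2^(w M + 2 - n M)` extensions to length `w M
+ 2`, at least one fails level `M`. -/
theorem card_survivors_succ_le {M D : ℕ} (hr : r M = true) (hn : n M + 1 ≤ w M)
    (hsep : ∀ j < M, r j = true → w j + 2 ≤ n M) (hD : w M + 2 ≤ D)
    (hmiss : ∀ p, ∃ m, m / 2 ^ (w M + 2 - n M) = p ∧ ¬ lvl M m) :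
    (survivors r w lvl (M + 1) D).card ≤
      2 ^ (D - (w M + 2)) * (2 ^ (w M + 2 - n M) - 1) * (survivors r w lvl M (n M)).card := by
  classical
  set k := D - (w M + 2) with hk
  set q := w M + 2 - n M with hq
  have hDn : D - n M = k + q := by omega
  set f : ℕ → ℕ := fun m => m / 2 ^ (D - n M) with hf
  refine (Finset.card_le_mul_card_image (f := f) _ (2 ^ k * (2 ^ q - 1)) ?_).trans ?_
  · intro p _
    obtain ⟨m₀, hm₀, hlvl⟩ := hmiss p
    refine (Finset.card_le_mul_card_image (f := fun m => m / 2 ^ k) _ (2 ^ k) ?_).trans ?_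
    · intro x _
      exact card_fiber_le (x := x) fun m hm => (Finset.mem_filter.1 hm).2
    · refine Nat.mul_le_mul_left _ ?_
      have hsub : ∀ T : Finset ℕ, (∀ x ∈ T, x / 2 ^ q = p ∧ x ≠ m₀) → T.card ≤ 2 ^ q - 1 := by
        intro T hT
        have h1 : m₀ ∉ T := fun h => (hT _ h).2 rfl
        have h2 : (insert m₀ T).card ≤ 2 ^ q := by
          refine card_fiber_le (x := p) fun x hx => ?_
          rcases Finset.mem_insert.1 hx with rfl | hx
          · exact hm₀
          · exact (hT x hx).1
        rw [Finset.card_insert_of_notMem h1] at h2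
        omega
      refine hsub _ fun x hx => ?_
      obtain ⟨m, hm, rfl⟩ := Finset.mem_image.1 hx
      obtain ⟨hm, hp⟩ := Finset.mem_filter.1 hm
      refine ⟨?_, fun h => hlvl ?_⟩
      · rw [Nat.div_div_eq_div_mul, ← pow_add, ← hDn]
        exact hp
      · rw [← h]
        exact (Finset.mem_filter.1 hm).2 M (Nat.lt_succ_self M) hr
  · refine Nat.mul_le_mul_left _ (Finset.card_le_card fun p hp => ?_)
    obtain ⟨m, hm, rfl⟩ := Finset.mem_image.1 hp
    obtain ⟨h1, h2⟩ := Finset.mem_filter.1 hm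
    refine Finset.mem_filter.2 ⟨?_, fun j hj hrj => ?_⟩
    · rw [Finset.mem_range] at h1 ⊢
      rw [Nat.div_lt_iff_lt_mul (by positivity), ← pow_add]
      rwa [show n M + (D - n M) = D by omega]
    · have h3 := hsep j hj hrj
      have h4 := h2 j (by omega) hrj
      rwa [hf, Nat.div_div_eq_div_mul, ← pow_add,
        show D - n M + (n M - (w j + 2)) = D - (w j + 2) by omega]

/-- The surviving proportion is at most the product of `1 - 2^(-(w j + 2 - n j))` over the retained
levels; without denominators it becomes a bound between naturals, which a computable search can use.
-/
theorem card_survivors_mul_le (hn : ∀ j, n j + 1 ≤ w j)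
    (hsep : ∀ i, r i = true → ∀ j < i, r j = true → w j + 2 ≤ n i)
    (hmiss : ∀ j p, ∃ m, m / 2 ^ (w j + 2 - n j) = p ∧ ¬ lvl j m) (M D : ℕ)
    (hD : ∀ j < M, r j = true → w j + 2 ≤ D) :
    (survivors r w lvl M D).card *
        ∏ j ∈ Finset.range M, (if r j = true then 2 ^ (w j + 2 - n j) else 1) ≤
      2 ^ D * ∏ j ∈ Finset.range M, (if r j = true then 2 ^ (w j + 2 - n j) - 1 else 1) := by
  classical
  induction M generalizing D with
  | zero => simp [survivors]
  | succ M ih =>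
    rw [Finset.prod_range_succ, Finset.prod_range_succ]
    by_cases hr : r M = true
    · have hDM := hD M (Nat.lt_succ_self M) hr
      have h1 := ih (n M) (fun j hj hrj => hsep M hr j hj hrj)
      have h2 := card_survivors_succ_le (lvl := lvl) hr (hn M)
        (fun j hj hrj => hsep M hr j hj hrj) hDM (hmiss M)
      rw [if_pos hr, if_pos hr]
      set Y := ∏ j ∈ Finset.range M, (if r j = true then 2 ^ (w j + 2 - n j) else 1)
      set X := ∏ j ∈ Finset.range M, (if r j = true then 2 ^ (w j + 2 - n j) - 1 else 1)
      have h3 : 2 ^ D = 2 ^ (D - (w M + 2)) * 2 ^ (w M + 2 - n M) * 2 ^ n M := by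
        have := hn M
        rw [← pow_add, ← pow_add]
        congr 1
        omega
      calc _ ≤ 2 ^ (D - (w M + 2)) * (2 ^ (w M + 2 - n M) - 1) *
            (survivors r w lvl M (n M)).card * (Y * 2 ^ (w M + 2 - n M)) :=
            Nat.mul_le_mul_right _ h2
        _ = 2 ^ (D - (w M + 2)) * (2 ^ (w M + 2 - n M) - 1) * 2 ^ (w M + 2 - n M) *
            ((survivors r w lvl M (n M)).card * Y) := by ring
        _ ≤ 2 ^ (D - (w M + 2)) * (2 ^ (w M + 2 - n M) - 1) * 2 ^ (w M + 2 - n M) *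
            (2 ^ n M * X) := Nat.mul_le_mul_left _ h1
        _ = _ := by rw [h3]; ring
    · rw [if_neg hr, if_neg hr, mul_one, mul_one]
      refine (Nat.mul_le_mul_right _ (Finset.card_le_card ?_)).trans
        (ih D fun j hj => hD j (by omega))
      intro m hm
      obtain ⟨h1, h2⟩ := Finset.mem_filter.1 hm
      exact Finset.mem_filter.2 ⟨h1, fun j hj => h2 j (by omega)⟩

end Counting

/-! ### The effectively null test formed by all levels. -/

theorem exists_computable_of_forall_exists {p : ℕ → ℕ → Bool} (hp : Computable₂ p)
    (h : ∀ k, ∃ m, p k m = true) : ∃ f : ℕ → ℕ, Computable f ∧ ∀ k, p k (f k) = true := by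
  refine ⟨fun k => Nat.find (h k), ?_, fun k => Nat.find_spec (h k)⟩
  have h1 : Partrec fun k => Nat.rfind fun m => (Part.some (p k m) : Part Bool) :=
    Partrec.rfind (p := fun k m => Part.some (p k m)) hp.partrec₂
  refine h1.of_eq_tot fun k => Nat.mem_rfind.2 ⟨?_, fun {m} hm => ?_⟩
  · rw [Nat.find_spec (h k)]
    exact Part.mem_some true
  · rw [Bool.eq_false_iff.2 (Nat.find_min (h k) hm)]
    exact Part.mem_some false

theorem computable_prod {α : Type*} [Primcodable α] {N : α → ℕ} {f : α → ℕ → ℕ}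
    (hN : Computable N) (hf : Computable₂ f) :
    Computable fun a => ∏ i ∈ Finset.range (N a), f a i := by
  have h : Computable₂ fun (a : α) (p : ℕ × ℕ) => p.2 * f a p.1 :=
    computable_mul (Computable.snd.comp Computable.snd)
      (hf.comp Computable.fst (Computable.fst.comp Computable.snd))
  refine (Computable.nat_rec hN (Computable.const 1) h).of_eq fun a => ?_
  induction N a with
  | zero => rfl
  | succ n ih => rw [Finset.prod_range_succ, ← ih]

theorem computable_compatible {α : Type*} [Primcodable α] {o : α → Option Bool} {d : α → Bool}
    {cell : α → ℕ} (ho : Computable o) (hd : Computable d) (hcell : Computable cell) (e : ℕ) :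
    Computable fun a => compatible (o a) (d a) e (cell a) :=
  computable_or
    (computable_and (computable_eq ho (Computable.option_some.comp hd))
      (computable_le hcell (Computable.const e)))
    (computable_and (computable_eq ho (Computable.option_some.comp (computable_not hd)))
      (computable_le (Computable.const e) hcell))

theorem computable_passes {α : Type*} [Primcodable α] {S : ℕ → List Bool → ℕ → Option Bool}
    (hS : Computable fun p : ℕ × List Bool × ℕ => S p.1 p.2.1 p.2.2) {s n w m : α → ℕ}
    (hs : Computable s) (hn : Computable n) (hw : Computable w) (hm : Computable m) :
    Computable fun a => passes (S (s a)) (n a) (w a) (m a) := by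
  have c : ∀ k : ℕ, Computable fun _ : α => k := fun k => Computable.const k
  have h8 : Computable fun a => m a / 8 := computable_div hm (c 8)
  have h4 : Computable fun a => m a / 4 := computable_div hm (c 4)
  have hc : Computable fun a => m a % 8 := computable_mod hm (c 8)
  have hw1 : Computable fun a => w a - 1 := computable_sub hw (c 1)
  have hd : Computable fun a => decide (m a / 2 ^ (w a + 2 - n a) % 2 = 1) :=
    computable_eq (computable_mod (computable_div hm (computable_two_pow
      (computable_sub (computable_add hw (c 2)) hn))) (c 2)) (c 1)
  have h1 : Computable fun a => !decide ((m a / 8 + 1) % 2 ^ (w a - 1 - n a) = 0) :=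
    computable_not (computable_eq (computable_mod (computable_add h8 (c 1))
      (computable_two_pow (computable_sub hw1 hn))) (c 0))
  have h2 : Computable fun a => S (s a) (bits (m a / 4) (w a)) (n a) :=
    computable₃_comp hS hs (computable_bits.comp h4 hw) hn
  have h3 : Computable fun a => S (s a) (bits (m a / 8) (w a - 1)) (n a) :=
    computable₃_comp hS hs (computable_bits.comp h8 hw1) hn
  exact computable_or h1 (computable_or (computable_compatible h2 hd hc 5)
    (computable_compatible h3 hd hc 3))

theorem passes_mono {S S' : List Bool → ℕ → Option Bool}
    (h : ∀ σ n b, S σ n = some b → S' σ n = some b) {n w m : ℕ} (hp : passes S n w m = true) :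
    passes S' n w m = true := by
  simp only [passes, Bool.or_eq_true, compatible_eq_true_iff] at hp ⊢
  rcases hp with hp | (⟨hp, h'⟩ | ⟨hp, h'⟩) | (⟨hp, h'⟩ | ⟨hp, h'⟩)
  · exact Or.inl hp
  · exact Or.inr (Or.inl (Or.inl ⟨h _ _ _ hp, h'⟩))
  · exact Or.inr (Or.inl (Or.inr ⟨h _ _ _ hp, h'⟩))
  · exact Or.inr (Or.inr (Or.inl ⟨h _ _ _ hp, h'⟩))
  · exact Or.inr (Or.inr (Or.inr ⟨h _ _ _ hp, h'⟩))

theorem floor_two_pow_div (x : ℝ) (a b : ℕ) :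
    ⌊(2 : ℝ) ^ (a + b) * x⌋₊ / 2 ^ b = ⌊(2 : ℝ) ^ a * x⌋₊ := by
  rw [← Nat.floor_div_natCast]
  congr 1
  push_cast
  rw [pow_add]
  field_simp

/-- Passing all retained levels below `M k` is an enumerable condition of measure at most `2^(-(k +
1))`, and `M` is found by search. Since `Ω` escapes one of these conditions, it fails some level. -/
theorem exists_not_passes_level {Ω : ℝ} (hΩ : IsOmegaNumber Ω) {n w : ℕ → ℕ} {r : ℕ → Bool}
    (hnc : Computable n) (hwc : Computable w) (hrc : Computable r)
    {S : ℕ → List Bool → ℕ → Option Bool}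
    (hSc : Computable fun p : ℕ × List Bool × ℕ => S p.1 p.2.1 p.2.2)
    (hSmono : ∀ s s' σ i b, s ≤ s' → S s σ i = some b → S s' σ i = some b)
    (hS : ∀ s s' σ τ i b b', σ <+: τ → S s σ i = some b → S s' τ i = some b' → b = b')
    (hn : ∀ j, n j + 1 ≤ w j)
    (hsep : ∀ i, r i = true → ∀ j < i, r j = true → w j + 2 ≤ n i)
    (hdiv : ∀ k : ℕ, ∃ M : ℕ,
      (∏ j ∈ Finset.range M, (if r j = true then 2 ^ (w j + 2 - n j) - 1 else 1)) * 2 ^ (k + 1) ≤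
        ∏ j ∈ Finset.range M, (if r j = true then 2 ^ (w j + 2 - n j) else 1)) :
    ∃ j, r j = true ∧ ∀ s, passes (S s) (n j) (w j) ⌊(2 : ℝ) ^ (w j + 2) * Ω⌋₊ = false := by
  have h0 : 0 ≤ Ω := by
    obtain ⟨U, _, hx⟩ := hΩ
    exact hx.nonneg
  have h1 : Ω < 1 := by
    obtain ⟨U, hU, hx⟩ := hΩ
    exact haltingProbability_lt_one hU hx
  have hq : Computable fun p : (ℕ × ℕ) × ℕ => 2 ^ (w p.2 + 2 - n p.2) :=
    computable_two_pow (computable_sub (computable_add (hwc.comp Computable.snd)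
      (Computable.const 2)) (hnc.comp Computable.snd))
  have hX : Computable fun p : ℕ × ℕ =>
      ∏ j ∈ Finset.range p.2, (if r j = true then 2 ^ (w j + 2 - n j) - 1 else 1) := by
    have h : Computable₂ fun (_ : ℕ × ℕ) (j : ℕ) =>
        if r j = true then 2 ^ (w j + 2 - n j) - 1 else 1 :=
      computable_ite (hrc.comp Computable.snd) (computable_sub hq (Computable.const 1))
        (Computable.const 1)
    exact computable_prod Computable.snd h
  have hY : Computable fun p : ℕ × ℕ =>
      ∏ j ∈ Finset.range p.2, (if r j = true then 2 ^ (w j + 2 - n j) else 1) := by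
    have h : Computable₂ fun (_ : ℕ × ℕ) (j : ℕ) =>
        if r j = true then 2 ^ (w j + 2 - n j) else 1 :=
      computable_ite (hrc.comp Computable.snd) hq (Computable.const 1)
    exact computable_prod Computable.snd h
  obtain ⟨M, hMc, hM⟩ := exists_computable_of_forall_exists (p := fun k m => decide
    ((∏ j ∈ Finset.range m, (if r j = true then 2 ^ (w j + 2 - n j) - 1 else 1)) * 2 ^ (k + 1) ≤
        ∏ j ∈ Finset.range m, (if r j = true then 2 ^ (w j + 2 - n j) else 1)))
    (computable_le (computable_mul hX (computable_two_pow (computable_add Computable.fst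
      (Computable.const 1)))) hY) (fun k => by simpa using hdiv k)
  simp only [decide_eq_true_eq] at hM
  -- A crude computable depth that is at least the depth of every level below `M k`.
  set L : ℕ → ℕ := fun k => ∑ j ∈ Finset.range (M k), (w j + 2) with hL
  have hLc : Computable L := by
    have h : Computable₂ fun (_ : ℕ) (j : ℕ) => w j + 2 :=
      computable_add (hwc.comp Computable.snd) (Computable.const 2)
    exact computable_sum hMc h
  have hLw : ∀ k, ∀ j < M k, w j + 2 ≤ L k := fun k j hj =>
    Finset.single_le_sum (f := fun j => w j + 2) (fun _ _ => Nat.zero_le _) (Finset.mem_range.2 hj)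
  set P : ℕ → ℕ → ℕ → Bool := fun k m s => decide (m < 2 ^ L k) && decide (∀ j < M k,
    (!r j || passes (S s) (n j) (w j) (m / 2 ^ (L k - (w j + 2)))) = true) with hP
  have hPc : Computable fun p : ℕ × ℕ × ℕ => P p.1 p.2.1 p.2.2 := by
    have hk : Computable fun p : ℕ × ℕ × ℕ => L p.1 := hLc.comp Computable.fst
    have hm : Computable fun p : ℕ × ℕ × ℕ => p.2.1 := Computable.fst.comp Computable.snd
    have hj : Computable fun q : (ℕ × ℕ × ℕ) × ℕ => q.2 := Computable.snd
    have hm' : Computable fun q : (ℕ × ℕ × ℕ) × ℕ =>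
        q.1.2.1 / 2 ^ (L q.1.1 - (w q.2 + 2)) :=
      computable_div (hm.comp Computable.fst) (computable_two_pow (computable_sub
        (hk.comp Computable.fst) (computable_add (hwc.comp hj) (Computable.const 2))))
    have hs : Computable fun q : (ℕ × ℕ × ℕ) × ℕ => q.1.2.2 :=
      Computable.snd.comp (Computable.snd.comp Computable.fst)
    have hin : Computable₂ fun (p : ℕ × ℕ × ℕ) (j : ℕ) =>
        !r j || passes (S p.2.2) (n j) (w j) (p.2.1 / 2 ^ (L p.1 - (w j + 2))) :=
      computable_or (computable_not (hrc.comp hj))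
        (computable_passes hSc hs (hnc.comp hj) (hwc.comp hj) hm')
    exact computable_and (computable_lt hm (computable_two_pow hk))
      (computable_forall_lt (hMc.comp Computable.fst) hin)
  have hpm : ∀ s s' j m, s ≤ s' → passes (S s) (n j) (w j) m = true →
      passes (S s') (n j) (w j) m = true := fun s s' j m hs =>
    passes_mono fun σ i b => hSmono s s' σ i b hs
  have hPmono : ∀ k m s s', s ≤ s' → P k m s = true → P k m s' = true := by
    intro k m s s' hs h
    simp only [hP, Bool.and_eq_true, decide_eq_true_eq, Bool.or_eq_true] at h ⊢
    exact ⟨h.1, fun j hj => (h.2 j hj).imp_right (hpm s s' j _ hs)⟩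
  have hbound : ∀ k, ∃ C : Finset ℕ, (∀ m s, P k m s = true → m ∈ C) ∧
      C.card * 2 ^ (k + 1) ≤ 2 ^ L k := by
    intro k
    classical
    set lvl : ℕ → ℕ → Prop := fun j m => ∃ s, passes (S s) (n j) (w j) m = true with hlvl
    refine ⟨survivors r w lvl (M k) (L k), fun m s h => ?_, ?_⟩
    · simp only [hP, Bool.and_eq_true, decide_eq_true_eq, Bool.or_eq_true] at h
      refine Finset.mem_filter.2 ⟨Finset.mem_range.2 h.1, fun j hj hrj => ⟨s, ?_⟩⟩
      exact (h.2 j hj).resolve_left (by simp [hrj])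
    · have h2 := card_survivors_mul_le (lvl := lvl) hn hsep (fun j p => by
        obtain ⟨m, hm, h⟩ := exists_not_passes (S := S) (hn j)
          (fun s s' σ τ b b' => hS s s' σ τ (n j) b b') p
        exact ⟨m, hm, fun ⟨s, hs⟩ => by simp [h s] at hs⟩) (M k) (L k)
        (fun j hj _ => hLw k j hj)
      have h3 := hM k
      set X := ∏ j ∈ Finset.range (M k), (if r j = true then 2 ^ (w j + 2 - n j) - 1 else 1)
      set Y := ∏ j ∈ Finset.range (M k), (if r j = true then 2 ^ (w j + 2 - n j) else 1) with hYd
      have hYpos : 0 < Y := Finset.prod_pos fun j _ => by split_ifs <;> positivity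
      refine Nat.le_of_mul_le_mul_right ?_ hYpos
      calc (survivors r w lvl (M k) (L k)).card * 2 ^ (k + 1) * Y
          = (survivors r w lvl (M k) (L k)).card * Y * 2 ^ (k + 1) := by ring
        _ ≤ 2 ^ L k * X * 2 ^ (k + 1) := Nat.mul_le_mul_right _ h2
        _ = 2 ^ L k * (X * 2 ^ (k + 1)) := by ring
        _ ≤ 2 ^ L k * Y := Nat.mul_le_mul_left _ h3
  obtain ⟨k, hk⟩ := exists_not_enumerated hΩ hLc hPc hPmono hbound
  by_contra hcon
  push Not at hcon
  have hall : ∀ j, ∃ s, r j = true →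
      passes (S s) (n j) (w j) ⌊(2 : ℝ) ^ (w j + 2) * Ω⌋₊ = true := by
    intro j
    by_cases hr : r j = true
    · obtain ⟨s, hs⟩ := hcon j hr
      exact ⟨s, fun _ => by simpa using hs⟩
    · exact ⟨0, fun h => absurd h hr⟩
  choose f hf using hall
  -- The sum serves as a common upper bound for the finitely many stages.
  set s := ∑ j ∈ Finset.range (M k), f j with hs
  have hcontra : P k ⌊(2 : ℝ) ^ L k * Ω⌋₊ s = true := by
    simp only [hP, Bool.and_eq_true, decide_eq_true_eq, Bool.or_eq_true]
    constructor
    · rw [Nat.floor_lt (by positivity)]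
      push_cast
      exact mul_lt_of_lt_one_right (by positivity) h1
    · intro j hj
      by_cases hr : r j = true
      · right
        have h2 := hLw k j hj
        have h3 := floor_two_pow_div Ω (w j + 2) (L k - (w j + 2))
        rw [show w j + 2 + (L k - (w j + 2)) = L k by omega] at h3
        rw [h3]
        exact hpm (f j) s j _ (Finset.single_le_sum (f := f) (fun _ _ => Nat.zero_le _)
          (Finset.mem_range.2 hj)) (hf j hr)
      · left
        simpa using hr
  rw [hk s] at hcontra
  exact Bool.false_ne_true hcontra

/-! ### The carry caused by the added summand. -/

/-- A block of ones followed by three zeros stands `8` units below a multiple of `8 * Q`, so the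
quotient grows exactly when the last digits and the addition reach `8`; `e < 16` and `1 ≤ Q` exclude
a second carry. -/
theorem div_eq_of_ones {a Q e : ℕ} (ha : 1 ≤ a) (hQ : 1 ≤ Q) (he : e < 16) :
    (8 * (a * Q) - 8 + e) / (8 * Q) = if e < 8 then a - 1 else a := by
  obtain ⟨a, rfl⟩ := Nat.exists_eq_add_of_le' ha
  have h1 : 8 * ((a + 1) * Q) = a * (8 * Q) + 8 * Q := by ring
  rw [h1, Nat.div_eq_iff (by positivity)]
  split_ifs with h
  · rw [Nat.add_sub_cancel]; omega
  · rw [add_mul]; omega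

theorem digit_eq_of_nonneg {x : ℝ} (hx : 0 ≤ x) (n : ℕ) :
    digit x n = decide (⌊(2 : ℝ) ^ n * x⌋₊ % 2 = 1) := by
  unfold digit
  have h2 : ⌊(2 : ℝ) ^ n * x⌋ = (⌊(2 : ℝ) ^ n * x⌋₊ : ℤ) :=
    (Int.natCast_floor_eq_floor (by positivity)).symm
  rw [h2, Bool.eq_iff_iff]
  simp only [decide_eq_true_eq]
  omega

/-- The true digits of `Ω + γ` pass the test. -/
theorem passes_of_digit {Ω ρ : ℝ} (hΩ : 0 ≤ Ω) (hρ : 0 ≤ ρ) {n w u G : ℕ} (hn : n + 1 ≤ w)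
    (hn1 : 1 ≤ n) (huw : u ≤ w) (hwu : w ≤ u + 1) (hρw : 2 ^ (w + 2) * ρ < 1)
    {S : List Bool → ℕ → Option Bool}
    (hS : S (firstDigits Ω u) n =
      some (digit (Ω + (G / 2 ^ (n - 1) + ((1 : ℝ) / 2) ^ (u + 1) + ρ)) n)) :
    passes S n w ⌊(2 : ℝ) ^ (w + 2) * Ω⌋₊ = true := by
  obtain ⟨k, rfl⟩ := Nat.exists_eq_add_of_le hn
  obtain ⟨n, rfl⟩ := Nat.exists_eq_add_of_le' hn1
  rw [Nat.add_sub_cancel] at hS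
  set w := n + 1 + 1 + k with hw
  set m := ⌊(2 : ℝ) ^ (w + 2) * Ω⌋₊ with hm
  set β := Ω + (G / 2 ^ n + ((1 : ℝ) / 2) ^ (u + 1) + ρ) with hβ
  have hβ0 : 0 ≤ β := by positivity
  unfold passes
  by_cases hones : (m / 8 + 1) % 2 ^ (w - 1 - (n + 1)) = 0
  swap
  · simp [hones]
  have hk : w - 1 - (n + 1) = k := by omega
  have hq : w + 2 - (n + 1) = k + 3 := by omega
  rw [hk] at hones
  obtain ⟨a, ha⟩ := Nat.dvd_of_mod_eq_zero hones
  set Q := 2 ^ k with hQ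
  have hQ1 : 1 ≤ Q := Nat.one_le_two_pow
  have h2q : 2 ^ (k + 3) = 8 * Q := by rw [pow_add]; ring
  have ha1 : 1 ≤ a := by
    rcases Nat.eq_zero_or_pos a with rfl | h
    · omega
    · exact h
  set c := m % 8 with hc
  have hc8 : c < 8 := Nat.mod_lt _ (by norm_num)
  have hma : m = 8 * (a * Q) - 8 + c := by rw [mul_comm a Q, ← ha]; omega
  -- the number of the string of the first `w + 2` digits of `β`
  set sh := 2 ^ (w + 1 - u) with hsh
  have hβm : ∃ ε < 2, ⌊(2 : ℝ) ^ (w + 2) * β⌋₊ = m + 16 * Q * G + sh + ε := by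
    have hG : (2 : ℝ) ^ (w + 2) * (G / 2 ^ n) = ((16 * Q * G : ℕ) : ℝ) := by
      rw [hw, hQ, show n + 1 + 1 + k + 2 = n + (k + 4) by omega, pow_add, pow_add]
      push_cast
      field_simp
      ring
    have hs : (2 : ℝ) ^ (w + 2) * ((1 : ℝ) / 2) ^ (u + 1) = (sh : ℝ) := by
      rw [hsh, show w + 2 = (u + 1) + (w + 1 - u) by omega, pow_add]
      push_cast
      rw [mul_right_comm, ← mul_pow]
      norm_num
    have hexp : (2 : ℝ) ^ (w + 2) * β =
        (2 ^ (w + 2) * Ω + 2 ^ (w + 2) * ρ) + ((16 * Q * G + sh : ℕ) : ℝ) := by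
      rw [hβ, mul_add, mul_add, mul_add, hG, hs]
      push_cast
      ring
    have hρ0 : 0 ≤ 2 ^ (w + 2) * ρ := by positivity
    have hΩ0 : 0 ≤ 2 ^ (w + 2) * Ω := by positivity
    have h1 : (m : ℝ) ≤ 2 ^ (w + 2) * Ω := Nat.floor_le hΩ0
    have h2 : 2 ^ (w + 2) * Ω < m + 1 := Nat.lt_floor_add_one _
    have h3 : m ≤ ⌊2 ^ (w + 2) * Ω + 2 ^ (w + 2) * ρ⌋₊ := Nat.le_floor (by linarith)
    have h4 : ⌊2 ^ (w + 2) * Ω + 2 ^ (w + 2) * ρ⌋₊ < m + 2 := by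
      rw [Nat.floor_lt (by positivity)]
      push_cast
      linarith
    rw [hexp, Nat.floor_add_natCast (by positivity)]
    exact ⟨⌊2 ^ (w + 2) * Ω + 2 ^ (w + 2) * ρ⌋₊ - m, by omega, by omega⟩
  obtain ⟨ε, hε, hβm⟩ := hβm
  -- In units of `2^(-(w + 2))` the summand is `2` or `4`. With the error `ε ∈ {0, 1}` a carry
  -- forces `c ≥ 5` or `c ≥ 3`, and no carry forces `c ≤ 5` or `c ≤ 3`: the thresholds in `passes`.
  have hsh24 : (u = w ∧ sh = 2) ∨ (u = w - 1 ∧ sh = 4) := by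
    rcases Nat.lt_or_ge u w with h | h
    · right
      refine ⟨by omega, ?_⟩
      rw [hsh, show w + 1 - u = 2 by omega]; rfl
    · left
      refine ⟨by omega, ?_⟩
      rw [hsh, show w + 1 - u = 1 by omega]; rfl
  have hmdiv : m / 2 ^ (k + 3) = a - 1 := by
    rw [h2q, hma, div_eq_of_ones ha1 hQ1 (by omega), if_pos hc8]
  -- The earlier summands enter as `2 * G` and do not affect the parity.
  have hβdiv : ⌊(2 : ℝ) ^ (n + 1) * β⌋₊ =
      if c + sh + ε < 8 then (a + 2 * G) - 1 else a + 2 * G := by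
    have h := floor_two_pow_div β (n + 1) (k + 3)
    rw [show n + 1 + (k + 3) = w + 2 by omega] at h
    have haQ : 1 ≤ a * Q := Nat.mul_pos ha1 hQ1
    rw [← h, hβm, h2q, ← div_eq_of_ones (a := a + 2 * G) (by omega) hQ1 (by
      rcases hsh24 with h | h <;> omega)]
    congr 1
    rw [hma, add_mul, show 16 * Q * G = 8 * (2 * G * Q) by ring]
    omega
  have hdig : digit β (n + 1) = decide (⌊(2 : ℝ) ^ (n + 1) * β⌋₊ % 2 = 1) :=
    digit_eq_of_nonneg hβ0 _
  set d := decide (m / 2 ^ (w + 2 - (n + 1)) % 2 = 1) with hd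
  rw [hq, hmdiv] at hd
  have hbit : digit β (n + 1) = if c + sh + ε < 8 then d else !d := by
    rw [hdig, hβdiv, hd]
    split_ifs
    · rw [Bool.eq_iff_iff]
      simp only [decide_eq_true_eq]
      omega
    · rw [Bool.eq_iff_iff, Bool.not_eq_true']
      simp only [decide_eq_true_eq, decide_eq_false_iff_not]
      omega
  have hpre : ∀ i ≤ w + 2, firstDigits Ω i = bits (m / 2 ^ (w + 2 - i)) i := by
    intro i hi
    rw [firstDigits_eq_bits hΩ]
    have h := floor_two_pow_div Ω i (w + 2 - i)
    rw [show i + (w + 2 - i) = w + 2 by omega] at h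
    rw [hm, h]
  simp only [Bool.or_eq_true, compatible_eq_true_iff]
  right
  rw [hbit] at hS
  rcases hsh24 with ⟨hu, hsh2⟩ | ⟨hu, hsh4⟩
  · left
    rw [hu, hpre _ (by omega), show w + 2 - w = 2 by omega] at hS
    rw [show (4 : ℕ) = 2 ^ 2 by norm_num, hS]
    split_ifs at hS ⊢ with h
    · left; exact ⟨rfl, by omega⟩
    · right; exact ⟨rfl, by omega⟩
  · right
    rw [hu, hpre _ (by omega), show w + 2 - (w - 1) = 3 by omega] at hS
    rw [show (8 : ℕ) = 2 ^ 3 by norm_num, hS]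
    split_ifs at hS ⊢ with h
    · left; exact ⟨rfl, by omega⟩
    · right; exact ⟨rfl, by omega⟩

/-! ### Approximating the added real, and rounding `g`. -/

/-- Exponents are overestimated and the division of naturals rounds down, so every stage is a lower
bound. For finitely many `j` the exponent is eventually right and the division exact. -/
theorem ApproximatesFromBelow.of_hasSum {u : ℕ → ℕ} {u' : ℕ → ℕ → ℕ} (hc : Computable₂ u')
    (hle : ∀ j s, u j ≤ u' j s) (heq : ∀ j, ∀ᶠ s in Filter.atTop, u' j s = u j) {γ : ℝ}
    (hγ : HasSum (fun j => ((1 : ℝ) / 2) ^ (u j + 1)) γ) :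
    ApproximatesFromBelow (fun s => ∑ j ∈ Finset.range s, 2 ^ s / 2 ^ (u' j s + 1)) γ := by
  have hterm : ∀ j s, ((2 ^ s / 2 ^ (u' j s + 1) : ℕ) : ℝ) / 2 ^ s ≤ (1 / 2) ^ (u j + 1) := by
    intro j s
    have h1 : ((2 ^ s / 2 ^ (u' j s + 1) : ℕ) : ℝ) ≤ 2 ^ s / 2 ^ (u' j s + 1) := by
      have := Nat.cast_div_le (α := ℝ) (m := 2 ^ s) (n := 2 ^ (u' j s + 1))
      push_cast at this
      exact this
    calc ((2 ^ s / 2 ^ (u' j s + 1) : ℕ) : ℝ) / 2 ^ s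
        ≤ (2 ^ s / 2 ^ (u' j s + 1)) / 2 ^ s := by gcongr
      _ = (1 / 2) ^ (u' j s + 1) := by rw [one_div, inv_pow]; field_simp
      _ ≤ _ := pow_le_pow_of_le_one (by norm_num) (by norm_num)
          (Nat.add_le_add_right (hle j s) 1)
  have hnn : ∀ j, (0 : ℝ) ≤ (1 / 2) ^ (u j + 1) := fun j => by positivity
  have hub : ∀ s, ((∑ j ∈ Finset.range s, 2 ^ s / 2 ^ (u' j s + 1) : ℕ) : ℝ) / 2 ^ s ≤ γ := by
    intro s
    rw [Nat.cast_sum, Finset.sum_div]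
    exact (Finset.sum_le_sum fun j _ => hterm j s).trans
      (sum_le_hasSum _ (fun j _ => hnn j) hγ)
  refine ⟨?_, hub, ?_⟩
  · have h : Computable₂ fun (s : ℕ) (j : ℕ) => 2 ^ s / 2 ^ (u' j s + 1) :=
      computable_div (computable_two_pow Computable.fst) (computable_two_pow
        (computable_add (hc.comp Computable.snd Computable.fst) (Computable.const 1)))
    exact computable_sum Computable.id h
  · refine tendsto_order.2 ⟨fun y hy => ?_, fun y hy =>
      Filter.Eventually.of_forall fun s => (hub s).trans_lt hy⟩
    obtain ⟨N, hN⟩ := (hγ.tendsto_sum_nat.eventually (lt_mem_nhds hy)).exists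
    have hall : ∀ᶠ s in Filter.atTop, ∀ j ∈ Finset.range N, u' j s = u j ∧ u j + 1 ≤ s :=
      (Finset.eventually_all _).2 fun j _ =>
        (heq j).and (Filter.eventually_ge_atTop (u j + 1))
    filter_upwards [hall, Filter.eventually_ge_atTop N] with s h1 h2
    refine hN.trans_le ?_
    rw [Nat.cast_sum, Finset.sum_div]
    refine le_trans (Finset.sum_le_sum fun j hj => ?_)
      (Finset.sum_le_sum_of_subset_of_nonneg (Finset.range_subset_range.2 h2)
        fun j _ _ => by positivity)
    obtain ⟨h3, h4⟩ := h1 j hj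
    rw [h3, Nat.pow_div h4 two_pos]
    push_cast
    rw [pow_sub₀ (2 : ℝ) two_ne_zero h4, one_div, inv_pow]
    field_simp
    exact le_rfl

/-- Rounding a rational approximation of `x` up to an integer. -/
theorem le_round {x : ℝ} {T u p q k : ℕ} (hu : (u : ℤ) = T + ⌊x⌋)
    (hx : |x - ((p : ℝ) - q) / 2 ^ k| ≤ (1 / 2) ^ k) :
    u ≤ (2 ^ k * T + p + 1 - q) / 2 ^ k := by
  have hu' : (u : ℝ) = T + ⌊x⌋ := by exact_mod_cast hu
  have h1 := Int.floor_le x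
  have h2 := (abs_le.1 hx).2
  have h2k : (0 : ℝ) < 2 ^ k := by positivity
  rw [one_div, inv_pow] at h2
  have h3 : x ≤ ((p : ℝ) - q + 1) / 2 ^ k := by
    rw [add_div, one_div]; linarith
  rw [le_div_iff₀ h2k] at h3
  rw [Nat.le_div_iff_mul_le (by positivity)]
  have h4 : (u : ℝ) * 2 ^ k + q ≤ 2 ^ k * T + p + 1 := by
    rw [hu']
    nlinarith
  have h5 : u * 2 ^ k + q ≤ 2 ^ k * T + p + 1 := by exact_mod_cast h4
  omega

/-- Rounding up errs by at most `2 * 2^(-k)`. With `k = 2` and `e = 1` this always applies and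
yields the computable `w`; with `e = 0` it gives convergence to `u`. -/
theorem round_le {x : ℝ} {T u p q k : ℕ} (hu : (u : ℤ) = T + ⌊x⌋)
    (hx : |x - ((p : ℝ) - q) / 2 ^ k| ≤ (1 / 2) ^ k) {e : ℕ}
    (he : x + 2 * (1 / 2) ^ k < ⌊x⌋ + 1 + e) :
    (2 ^ k * T + p + 1 - q) / 2 ^ k ≤ u + e := by
  have hu' : (u : ℝ) = T + ⌊x⌋ := by exact_mod_cast hu
  have h2 := (abs_le.1 hx).1
  have h2k : (0 : ℝ) < 2 ^ k := by positivity
  rw [one_div, inv_pow] at h2 he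
  have h3 : ((p : ℝ) - q + 1) / 2 ^ k < ⌊x⌋ + 1 + e := by
    rw [add_div, one_div]; linarith
  rw [div_lt_iff₀ h2k] at h3
  rw [← Nat.lt_succ_iff, Nat.div_lt_iff_lt_mul (by positivity)]
  have h4 : (2 : ℝ) ^ k * T + p + 1 < (u + e + 1) * 2 ^ k + q := by
    rw [hu']
    nlinarith
  have h5 : 2 ^ k * T + p + 1 < (u + e + 1) * 2 ^ k + q := by exact_mod_cast h4
  have h6 : 0 < (u + e + 1) * 2 ^ k := by positivity
  rw [Nat.succ_eq_add_one]
  omega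

theorem eventually_round_eq {x : ℝ} {T u : ℕ} {p q : ℕ → ℕ} (hu : (u : ℤ) = T + ⌊x⌋)
    (hx : ∀ k, |x - ((p k : ℝ) - q k) / 2 ^ k| ≤ (1 / 2) ^ k) :
    ∀ᶠ k in Filter.atTop, (2 ^ k * T + p k + 1 - q k) / 2 ^ k = u := by
  have h1 : Filter.Tendsto (fun k : ℕ => x + 2 * ((1 : ℝ) / 2) ^ k) Filter.atTop
      (nhds (x + 2 * 0)) :=
    ((tendsto_pow_atTop_nhds_zero_of_lt_one (by norm_num) (by norm_num)).const_mul 2).const_add x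
  have h2 : x + 2 * 0 < ⌊x⌋ + 1 := by linarith [Int.lt_floor_add_one x]
  filter_upwards [h1.eventually (gt_mem_nhds h2)] with k hk
  exact le_antisymm (round_le hu (hx k) (e := 0) (by simpa using hk)) (le_round hu (hx k))

/-! ### Divergence of the defects, and the contradiction. -/

/-- Infinite products with divergent defects vanish. -/
theorem exists_prod_mul_le {r : ℕ → Bool} {q : ℕ → ℕ}
    (h : ¬ Summable fun j => if r j = true then ((1 : ℝ) / 2) ^ q j else 0) (k : ℕ) :
    ∃ M : ℕ, (∏ j ∈ Finset.range M, (if r j = true then 2 ^ q j - 1 else 1)) * 2 ^ (k + 1) ≤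
        ∏ j ∈ Finset.range M, (if r j = true then 2 ^ q j else 1) := by
  set ε : ℕ → ℝ := fun j => if r j = true then ((1 : ℝ) / 2) ^ q j else 0 with hε
  have h0 : ∀ j, 0 ≤ ε j := fun j => by simp only [hε]; split_ifs <;> positivity
  have h1 : ∀ j, ε j ≤ 1 := fun j => by
    simp only [hε]
    split_ifs
    · exact pow_le_one₀ (by norm_num) (by norm_num)
    · norm_num
  have hdiv := (not_summable_iff_tendsto_nat_atTop_of_nonneg h0).1 h
  have hexp := Real.tendsto_exp_neg_atTop_nhds_zero.comp hdiv
  obtain ⟨M, hM⟩ := (hexp.eventually (gt_mem_nhds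
    (show (0 : ℝ) < 1 / 2 ^ (k + 1) by positivity))).exists
  refine ⟨M, ?_⟩
  -- Each factor satisfies `1 - ε j ≤ exp (-ε j)`, and the sum of the `ε j` diverges.
  have hprod : ∏ j ∈ Finset.range M, (1 - ε j) ≤ 1 / 2 ^ (k + 1) := by
    refine le_trans ?_ hM.le
    simp only [Function.comp_apply]
    rw [← Finset.sum_neg_distrib, Real.exp_sum]
    refine Finset.prod_le_prod (fun j _ => by linarith [h1 j]) fun j _ => ?_
    have := Real.add_one_le_exp (-ε j)
    linarith
  have hsplit : ((∏ j ∈ Finset.range M, (if r j = true then 2 ^ q j - 1 else 1) : ℕ) : ℝ) =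
      (∏ j ∈ Finset.range M, (1 - ε j)) *
        ((∏ j ∈ Finset.range M, (if r j = true then 2 ^ q j else 1) : ℕ) : ℝ) := by
    rw [Nat.cast_prod, Nat.cast_prod, ← Finset.prod_mul_distrib]
    refine Finset.prod_congr rfl fun j _ => ?_
    simp only [hε]
    split_ifs
    · rw [Nat.cast_sub Nat.one_le_two_pow]
      push_cast
      rw [one_div, inv_pow]
      field_simp
    · simp
  have hfin : ((∏ j ∈ Finset.range M, (if r j = true then 2 ^ q j - 1 else 1) : ℕ) : ℝ) *
      2 ^ (k + 1) ≤ ((∏ j ∈ Finset.range M, (if r j = true then 2 ^ q j else 1) : ℕ) : ℝ) := by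
    rw [hsplit]
    rw [le_div_iff₀ (by positivity)] at hprod
    have hY : (0 : ℝ) ≤
        ((∏ j ∈ Finset.range M, (if r j = true then 2 ^ q j else 1) : ℕ) : ℝ) := by positivity
    nlinarith
  exact_mod_cast hfin

/-- Reading one digit off the functional's output gives consistent predictions. Randomness supplies
a retained level that `Ω` fails, but the functional predicts the true digit of `β` there, which
makes `Ω` pass. -/
theorem not_computesWithRedundancy {Ω β : ℝ} {g : ℕ → ℝ} (hΩ : IsOmegaNumber Ω)
    (hmono : Monotone g) {T n u w : ℕ → ℕ} {r : ℕ → Bool} (hnc : Computable n)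
    (hwc : Computable w) (hrc : Computable r) (hu : ∀ j, (u j : ℤ) = T j + ⌊g (T j)⌋)
    (hnT : ∀ j, n j ≤ T j) (hn1 : ∀ j, 1 ≤ n j) (hnw : ∀ j, n j + 1 ≤ w j)
    (huw : ∀ j, u j ≤ w j) (hwu : ∀ j, w j ≤ u j + 1) (hu4 : ∀ j, u j + 4 ≤ u (j + 1))
    (hsep : ∀ i, r i = true → ∀ j < i, w j + 2 ≤ n i)
    (hdiv : ¬ Summable fun j => if r j = true then ((1 : ℝ) / 2) ^ (w j + 2 - n j) else 0)
    (hβ : HasSum (fun j => ((1 : ℝ) / 2) ^ (u j + 1)) (β - Ω)) :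
    ¬ ComputesWithRedundancy Ω β g := by
  rintro ⟨Φ, ⟨hΦ, hΦmono⟩, hΦβ⟩
  have h0 : 0 ≤ Ω := by
    obtain ⟨U, _, hx⟩ := hΩ
    exact hx.nonneg
  -- Digit `i` has list index `i - 1`; the default `false` plays no role for outputs of length `i ≥
  -- 1`.
  set f : List Bool × ℕ →. Bool := fun p => (Φ p.1 p.2).map fun y => y.getD (p.2 - 1) false
    with hf
  have hfc : Partrec f := by
    have hg : Computable₂ fun (p : List Bool × ℕ) (y : List Bool) => y.getD (p.2 - 1) false :=
      (Primrec.list_getD false).to_comp.comp Computable.snd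
        (computable_sub (Computable.snd.comp Computable.fst) (Computable.const 1))
    exact Partrec.map hΦ hg
  obtain ⟨F, hFc, hFmono, hFmem⟩ := exists_stage hfc
  have hSc : Computable fun p : ℕ × List Bool × ℕ => F p.1 (p.2.1, p.2.2) := by
    have := hFc.comp (Computable.fst (α := ℕ) (β := List Bool × ℕ)) Computable.snd
    exact this
  obtain ⟨j, hrj, hj⟩ := exists_not_passes_level hΩ (S := fun s σ i => F s (σ, i)) hnc hwc hrc hSc
    (fun s s' σ i b hs h => hFmono s s' (σ, i) b hs h)
    (fun s s' σ τ i b b' hστ h h' => by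
      have h1 := (hFmem (σ, i) b).2 ⟨s, h⟩
      have h2 := (hFmem (τ, i) b').2 ⟨s', h'⟩
      obtain ⟨y, hy, rfl⟩ := (Part.mem_map_iff _).1 h1
      exact Part.mem_unique (Part.mem_map (fun y => y.getD (i - 1) false) (hΦmono σ τ i y hστ hy)) h2)
    hnw (fun i hi j hj _ => hsep i hi j hj) (exists_prod_mul_le hdiv)
  have hdig : digit β (n j) ∈ f (firstDigits Ω (u j), n j) := by
    -- As `g` is monotone and `n j ≤ T j`, the use at `n j` is at most that at `T j`.
    have hle : ⌊(n j : ℝ) + g (n j)⌋.toNat ≤ u j := by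
      rw [Int.toNat_le, hu]
      have h1 : (n j : ℝ) + g (n j) ≤ T j + g (T j) :=
        add_le_add (by exact_mod_cast hnT j) (hmono (hnT j))
      refine (Int.floor_le_floor h1).trans ?_
      rw [add_comm, Int.floor_add_natCast, add_comm]
    have h1 := hΦmono _ _ (n j) _ (firstDigits_prefix Ω hle) (hΦβ (n j))
    have h2 : (firstDigits β (n j)).getD (n j - 1) false = digit β (n j) := by
      have h3 := hn1 j
      have h4 : n j - 1 < n j := by omega
      simp [firstDigits, List.getD, h4, Nat.sub_add_cancel h3]
    rw [← h2]
    exact Part.mem_map _ h1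
  obtain ⟨s, hs⟩ := (hFmem _ _).1 hdig
  have hsum := hβ.summable
  have hsplit : β - Ω = ∑ i ∈ Finset.range j, ((1 : ℝ) / 2) ^ (u i + 1) +
      (((1 : ℝ) / 2) ^ (u j + 1) + ∑' i, ((1 : ℝ) / 2) ^ (u (i + (j + 1)) + 1)) := by
    rw [← hβ.tsum_eq, ← hsum.sum_add_tsum_nat_add (j + 1), Finset.sum_range_succ, add_assoc]
  set ρ := ∑' i, ((1 : ℝ) / 2) ^ (u (i + (j + 1)) + 1) with hρ
  have hρ0 : 0 ≤ ρ := tsum_nonneg fun i => by positivity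
  have hui : ∀ i, u j + 4 + i ≤ u (i + (j + 1)) := by
    intro i
    induction i with
    | zero => simpa using hu4 j
    | succ i ih =>
      have := hu4 (i + (j + 1))
      rw [show i + 1 + (j + 1) = i + (j + 1) + 1 by omega]
      omega
  have hρle : ρ ≤ (1 / 2) ^ (u j + 4) := by
    have hgeo : HasSum (fun i : ℕ => ((1 : ℝ) / 2) ^ (u j + 5) * (1 / 2) ^ i)
        ((1 / 2) ^ (u j + 5) * 2) := hasSum_geometric_two.mul_left _
    refine (((summable_nat_add_iff (j + 1)).2 hsum).tsum_le_tsum (fun i => ?_)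
      hgeo.summable).trans ?_
    · rw [← pow_add]
      exact pow_le_pow_of_le_one (by norm_num) (by norm_num) (by have := hui i; omega)
    · rw [hgeo.tsum_eq, show u j + 5 = u j + 4 + 1 by omega, pow_succ]
      linarith
  -- The gaps of `4` between the `u j` keep all later summands together below one unit of the test.
  have hρw : 2 ^ (w j + 2) * ρ < 1 := by
    have h1 : (2 : ℝ) ^ (w j + 2) ≤ 2 ^ (u j + 3) :=
      pow_le_pow_right₀ (by norm_num) (by have := hwu j; omega)
    calc 2 ^ (w j + 2) * ρ ≤ 2 ^ (u j + 3) * (1 / 2) ^ (u j + 4) := by gcongr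
      _ = 1 / 2 := by
        rw [show u j + 4 = u j + 3 + 1 by omega, pow_succ (1 / 2 : ℝ), ← mul_assoc, ← mul_pow]
        norm_num
      _ < 1 := by norm_num
  set G := ∑ i ∈ Finset.range j, 2 ^ (n j - 1 - (u i + 1)) with hG
  -- Separation gives `u i + 1 ≤ n j - 1`, so the earlier summands are multiples of `2^(-(n j -
  -- 1))`.
  have hGeq : ∑ i ∈ Finset.range j, ((1 : ℝ) / 2) ^ (u i + 1) = (G : ℝ) / 2 ^ (n j - 1) := by
    rw [hG, Nat.cast_sum, Finset.sum_div]
    refine Finset.sum_congr rfl fun i hi => ?_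
    have h1 := hsep j hrj i (Finset.mem_range.1 hi)
    have h2 := huw i
    push_cast
    rw [pow_sub₀ (2 : ℝ) two_ne_zero (by omega), one_div, inv_pow]
    field_simp
  have hβeq : β = Ω + (G / 2 ^ (n j - 1) + ((1 : ℝ) / 2) ^ (u j + 1) + ρ) := by
    rw [← hGeq]
    linarith
  have hpass := passes_of_digit (S := fun σ i => F s (σ, i)) h0 hρ0 (hnw j) (hn1 j) (huw j)
    (hwu j) hρw (hβeq ▸ hs)
  rw [hj s] at hpass
  exact Bool.false_ne_true hpass

theorem hasSum_gt_iff {f : ℕ → ℝ} {c : ℕ} {x : ℝ} :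
    HasSum (fun i : {i : ℕ // c < i} => f i) x ↔ HasSum (fun j => f (j + (c + 1))) x := by
  have h1 := hasSum_subtype_iff_indicator (f := f) (s := {i | c < i}) (a := x)
  have hinj : Function.Injective fun j : ℕ => j + (c + 1) := add_left_injective _
  have h2 := hinj.hasSum_iff (f := Set.indicator {i | c < i} f) (a := x) fun i hi =>
    Set.indicator_of_notMem (fun h => hi ⟨i - (c + 1), by
      have : c < i := h
      simp only
      omega⟩) f
  refine (h1.trans h2.symm).trans ?_
  have h3 : Set.indicator {i | c < i} f ∘ (fun j : ℕ => j + (c + 1)) =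
      fun j => f (j + (c + 1)) := by
    funext j
    exact Set.indicator_of_mem (by change c < j + (c + 1); omega) f
  rw [h3]

/-- If level `j + 1` is discarded, then `T (j+1)` is at most `T j + g (T j) + d + 3`, so by
monotonicity `2^(-g (T (j+1)))` is at most `2^(d+3) * 2^(T j - T (j+1))`, a summable bound. On
retained levels `w - n + 2` exceeds `g (T j)` by at most `d + 3`, so the divergence remains. -/
theorem not_summable_retained {g : ℕ → ℝ} (hmono : Monotone g) {T n u w : ℕ → ℕ} {d : ℕ}
    (hT : StrictMono T) (hu : ∀ j, (u j : ℤ) = T j + ⌊g (T j)⌋) (hn : ∀ j, T j = n j + d)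
    (hwu : ∀ j, w j ≤ u j + 1) (hnw : ∀ j, n j + 1 ≤ w j)
    (hdiv : ¬ Summable fun j => (2 : ℝ) ^ (-g (T j)))
    (hconv : Summable fun j => (2 : ℝ) ^ ((T j : ℤ) - (T (j + 1) : ℤ))) :
    ¬ Summable fun j => if (decide (j = 0) || decide (w (j - 1) + 2 ≤ n j)) = true
      then ((1 : ℝ) / 2) ^ (w j + 2 - n j) else 0 := by
  intro h
  refine hdiv ((summable_nat_add_iff 1).1 ?_)
  have hs := ((summable_nat_add_iff 1).2 h).add hconv
  refine Summable.of_nonneg_of_le (fun j => by positivity) (fun j => ?_)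
    (hs.mul_left ((2 : ℝ) ^ (d + 3)))
  have hfl : ∀ j, (u j : ℝ) ≤ T j + g (T j) := fun j => by
    have h1 : (u j : ℝ) = T j + ⌊g (T j)⌋ := by exact_mod_cast hu j
    linarith [Int.floor_le (g (T j))]
  have hc1 : (T (j + 1) : ℝ) = n (j + 1) + d := by exact_mod_cast hn (j + 1)
  simp only [Nat.add_sub_cancel, Nat.succ_ne_zero, decide_false, Bool.false_or,
    decide_eq_true_eq]
  split_ifs with hr
  · have h2 : ((1 : ℝ) / 2) ^ (w (j + 1) + 2 - n (j + 1)) =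
        (2 : ℝ) ^ (-((w (j + 1) + 2 - n (j + 1) : ℕ) : ℝ)) := by
      rw [Real.rpow_neg (by norm_num), Real.rpow_natCast, one_div, inv_pow]
    have h3 : (w (j + 1) : ℝ) ≤ u (j + 1) + 1 := by exact_mod_cast hwu (j + 1)
    have h4 := hnw (j + 1)
    have h5 : ((w (j + 1) + 2 - n (j + 1) : ℕ) : ℝ) = w (j + 1) + 2 - n (j + 1) := by
      rw [Nat.cast_sub (by omega)]
      push_cast
      ring
    have h6 := hfl (j + 1)
    calc (2 : ℝ) ^ (-g (T (j + 1)))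
        ≤ (2 : ℝ) ^ (((d + 3 : ℕ) : ℝ) + -((w (j + 1) + 2 - n (j + 1) : ℕ) : ℝ)) := by
          refine Real.rpow_le_rpow_of_exponent_le (by norm_num) ?_
          rw [h5]
          push_cast
          linarith
      _ = 2 ^ (d + 3) * (1 / 2) ^ (w (j + 1) + 2 - n (j + 1)) := by
          rw [Real.rpow_add (by norm_num), Real.rpow_natCast, h2]
      _ ≤ _ := by
          gcongr
          exact le_add_of_nonneg_right (by positivity)
  · have h7 : n (j + 1) < w j + 2 := not_le.1 hr
    have h8 : (n (j + 1) : ℝ) < w j + 2 := by exact_mod_cast h7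
    have h3 : (w j : ℝ) ≤ u j + 1 := by exact_mod_cast hwu j
    have h6 := hfl j
    have h9 := hmono (hT (Nat.lt_succ_self j)).le
    calc (2 : ℝ) ^ (-g (T (j + 1)))
        ≤ (2 : ℝ) ^ (((d + 3 : ℕ) : ℝ) + (((T j : ℤ) - (T (j + 1) : ℤ) : ℤ) : ℝ)) := by
          refine Real.rpow_le_rpow_of_exponent_le (by norm_num) ?_
          push_cast
          rw [Nat.succ_eq_add_one] at h9
          linarith
      _ = 2 ^ (d + 3) * (0 + (2 : ℝ) ^ ((T j : ℤ) - (T (j + 1) : ℤ))) := by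
          rw [Real.rpow_add (by norm_num), Real.rpow_natCast, Real.rpow_intCast, zero_add]
      _ ≤ _ := le_rfl

end OmegaRedundancy

/-! ### Choice of the parameters. -/

theorem mainTheorem3 (g : ℕ → ℝ) (hg : OmegaRedundancy.IsComputableRealFunction g)
    (hmono : Monotone g) (t : ℕ → ℕ) (ht : Computable t) (htmono : StrictMono t)
    (hgap : ∀ᶠ i : ℕ in Filter.atTop, (t i : ℝ) + g (t i) < (t (i + 1) : ℝ))
    (hdiv : ¬ Summable fun i : ℕ => (2 : ℝ) ^ (-g (t i)))
    (hconv : Summable fun i : ℕ => (2 : ℝ) ^ ((t i : ℤ) - (t (i + 1) : ℤ)))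
    (Ω : ℝ) (hΩ : OmegaRedundancy.IsOmegaNumber Ω) :
    ∃ (c : ℕ) (β : ℝ),
      HasSum (fun i : {i : ℕ // c < i} =>
        (2 : ℝ) ^ (-((t (i : ℕ) : ℤ) + ⌊g (t (i : ℕ))⌋ + 1))) (β - Ω) ∧
      OmegaRedundancy.IsOmegaNumber β ∧ β ≠ Ω ∧
      ¬ OmegaRedundancy.ComputesWithRedundancy Ω β g := by
  open OmegaRedundancy in
  obtain ⟨p, q, hp, hq, hpq⟩ := hg
  have hΩ1 : Ω < 1 := by
    obtain ⟨U, hU, hx⟩ := hΩ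
    exact haltingProbability_lt_one hU hx
  -- Since `1 - d` bounds `g` from below, `n j = T j - d` is less than `u j` even where `g` is
  -- negative.
  obtain ⟨d, hd⟩ := exists_nat_ge (1 - g 0)
  have hgd : ∀ m, 1 - (d : ℝ) ≤ g m := fun m => by linarith [hmono (Nat.zero_le m)]
  have hfd : ∀ m, 1 - (d : ℤ) ≤ ⌊g m⌋ := fun m => by
    rw [Int.le_floor]
    push_cast
    exact hgd m
  set f : ℕ → ℝ := fun i => (2 : ℝ) ^ (-((t i : ℤ) + ⌊g (t i)⌋ + 1)) with hf
  have hfpos : ∀ i, 0 < f i := fun i => by positivity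
  have hfs : Summable f := by
    refine Summable.of_nonneg_of_le (fun i => (hfpos i).le) (fun i => ?_)
      (summable_geometric_two.mul_left ((2 : ℝ) ^ d))
    have h1 := htmono.id_le i
    have h2 := hfd (t i)
    calc f i ≤ (2 : ℝ) ^ ((d : ℤ) - i) := by
          refine zpow_le_zpow_right₀ (by norm_num) ?_
          simp only [id_eq] at h1
          omega
      _ = 2 ^ d * (1 / 2) ^ i := by
          rw [zpow_sub₀ (by norm_num), zpow_natCast, zpow_natCast, one_div, inv_pow]
          rfl
  -- the choice of the constant
  have hc : ∀ᶠ c : ℕ in Filter.atTop, (∀ i, c ≤ i → t i + 4 ≤ t (i + 1)) ∧ d + 1 ≤ t c ∧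
      ∑' j, f (j + c) < (1 - Ω) / 2 := by
    have h1 : ∀ᶠ c : ℕ in Filter.atTop, ∀ i, c ≤ i → t i + 4 ≤ t (i + 1) := by
      -- Terms below `2^(-3)` force gaps of at least `4`.
      have h := hconv.tendsto_atTop_zero.eventually (gt_mem_nhds
        (show (0 : ℝ) < 2 ^ (-3 : ℤ) by positivity))
      obtain ⟨N, hN⟩ := Filter.eventually_atTop.1 h
      filter_upwards [Filter.eventually_ge_atTop N] with c hc i hi
      have h2 := (zpow_lt_zpow_iff_right₀ (by norm_num)).1 (hN i (hc.trans hi))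
      omega
    have h2 : ∀ᶠ c : ℕ in Filter.atTop, d + 1 ≤ t c :=
      htmono.tendsto_atTop.eventually_ge_atTop (d + 1)
    have h3 := (tendsto_sum_nat_add f).eventually (gt_mem_nhds
      (show (0 : ℝ) < (1 - Ω) / 2 by linarith))
    exact h1.and (h2.and h3)
  obtain ⟨c', hc'⟩ := Filter.eventually_atTop.1 hc
  -- The sum runs over `i > c'`, so its first index is `c' + 1`.
  obtain ⟨hgap4, htd, hγlt⟩ := hc' (c' + 1) (Nat.le_succ c')
  set T : ℕ → ℕ := fun j => t (j + (c' + 1)) with hT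
  have hTmono : StrictMono T := fun i j hij => htmono (Nat.add_lt_add_right hij _)
  have hTd : ∀ j, d + 1 ≤ T j := fun j => htd.trans (htmono.monotone (Nat.le_add_left _ _))
  have hTc : Computable T := ht.comp (computable_add Computable.id (Computable.const (c' + 1)))
  set u : ℕ → ℕ := fun j => ((T j : ℤ) + ⌊g (T j)⌋).toNat with hu'
  have hu : ∀ j, (u j : ℤ) = T j + ⌊g (T j)⌋ := fun j => by
    have h1 := hfd (T j)
    have h2 := hTd j
    rw [hu', Int.toNat_of_nonneg]
    omega
  set v : ℕ → ℕ → ℕ := fun j s => (2 ^ s * T j + p (T j) s + 1 - q (T j) s) / 2 ^ s with hv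
  have hvc : Computable₂ v := by
    have hTj : Computable fun x : ℕ × ℕ => T x.1 := hTc.comp Computable.fst
    have h2s : Computable fun x : ℕ × ℕ => 2 ^ x.2 := computable_two_pow Computable.snd
    exact computable_div (computable_sub (computable_add (computable_add
      (computable_mul h2s hTj) (hp.comp hTj Computable.snd)) (Computable.const 1))
      (hq.comp hTj Computable.snd)) h2s
  have huv : ∀ j s, u j ≤ v j s := fun j s => le_round (hu j) (hpq (T j) s)
  have hveq : ∀ j, ∀ᶠ s in Filter.atTop, v j s = u j := fun j =>
    eventually_round_eq (hu j) (hpq (T j))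
  -- Precision `2^(-2)` already determines `u j` up to an excess of at most `1`.
  set w : ℕ → ℕ := fun j => v j 2 with hw
  have hwc : Computable w := hvc.comp Computable.id (Computable.const 2)
  have hwu : ∀ j, w j ≤ u j + 1 := fun j => by
    refine round_le (hu j) (hpq (T j) 2) (e := 1) ?_
    have := Int.lt_floor_add_one (g (T j))
    norm_num
    linarith
  set n : ℕ → ℕ := fun j => T j - d with hn
  have hnc : Computable n := computable_sub hTc (Computable.const d)
  have hTn : ∀ j, T j = n j + d := fun j =>
    (Nat.sub_add_cancel ((Nat.le_succ d).trans (hTd j))).symm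
  have hnw : ∀ j, n j + 1 ≤ w j := fun j => by
    have h1 := hfd (T j)
    have h2 := hTn j
    have h3 := hu j
    have h4 : u j ≤ w j := huv j 2
    omega
  have hu4 : ∀ j, u j + 4 ≤ u (j + 1) := fun j => by
    have h1 := hgap4 (j + (c' + 1)) (Nat.le_add_left _ _)
    rw [show j + (c' + 1) + 1 = j + 1 + (c' + 1) by omega] at h1
    have h2 : T j + 4 ≤ T (j + 1) := h1
    have h3 := Int.floor_le_floor (hmono (show T j ≤ T (j + 1) by omega))
    have h4 := hu j
    have h5 := hu (j + 1)
    omega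
  have humono : Monotone u := monotone_nat_of_le_succ fun j => (Nat.le_add_right _ 4).trans (hu4 j)
  -- Level `0` is always kept, as `j - 1` is truncated there. Comparing neighbours is enough,
  -- because `u` grows by at least `4` at each step.
  set r : ℕ → Bool := fun j => decide (j = 0) || decide (w (j - 1) + 2 ≤ n j) with hr
  have hrc : Computable r :=
    computable_or (computable_eq Computable.id (Computable.const 0))
      (computable_le (computable_add (hwc.comp (computable_sub Computable.id
        (Computable.const 1))) (Computable.const 2)) hnc)
  have hsep : ∀ i, r i = true → ∀ j < i, w j + 2 ≤ n i := by
    intro i hi j hj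
    obtain ⟨i, rfl⟩ : ∃ k, i = k + 1 := Nat.exists_eq_add_of_le' (by omega)
    have h1 : w i + 2 ≤ n (i + 1) := by simpa [hr] using hi
    rcases Nat.lt_succ_iff_lt_or_eq.1 hj with h | rfl
    · have h2 := humono (show j + 1 ≤ i from h)
      have h3 := hu4 j
      have h4 := hwu j
      have h5 : u i ≤ w i := huv i 2
      omega
    · exact h1
  have hdivT : ¬ Summable fun j => (2 : ℝ) ^ (-g (T j)) := fun h =>
    hdiv ((summable_nat_add_iff (c' + 1)).1 h)
  have hconvT : Summable fun j => (2 : ℝ) ^ ((T j : ℤ) - (T (j + 1) : ℤ)) := by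
    have h := (summable_nat_add_iff (c' + 1)).2 hconv
    refine h.congr fun j => ?_
    simp only [hT, show j + (c' + 1) + 1 = j + 1 + (c' + 1) by omega]
  have hfu : ∀ j, f (j + (c' + 1)) = ((1 : ℝ) / 2) ^ (u j + 1) := fun j => by
    have h1 : (t (j + (c' + 1)) : ℤ) + ⌊g (t (j + (c' + 1)))⌋ + 1 = ((u j + 1 : ℕ) : ℤ) := by
      push_cast
      rw [hu j]
    simp only [hf]
    rw [h1, zpow_neg, zpow_natCast, one_div, inv_pow]
  have hγ := ((summable_nat_add_iff (c' + 1)).2 hfs).hasSum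
  set γ := ∑' j, f (j + (c' + 1)) with hγdef
  have hγpos : 0 < γ := ((summable_nat_add_iff (c' + 1)).2 hfs).tsum_pos
    (fun j => (hfpos _).le) 0 (hfpos _)
  have hγu : HasSum (fun j => ((1 : ℝ) / 2) ^ (u j + 1)) γ := by
    simpa only [hfu] using hγ
  refine ⟨c', Ω + γ, ?_, ?_, ?_, ?_⟩
  · rw [add_sub_cancel_left]
    exact (hasSum_gt_iff (f := f)).2 hγ
  · exact isOmegaNumber_add hΩ (ApproximatesFromBelow.of_hasSum hvc huv hveq hγu) (by linarith)
  · linarith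
  · exact not_computesWithRedundancy hΩ hmono hnc hwc hrc hu (fun j => Nat.sub_le _ _)
      (fun j => by have := hTd j; have := hTn j; omega) hnw (fun j => huv j 2) hwu hu4 hsep
      (not_summable_retained hmono hTmono hu hTn hwu hnw hdivT hconvT)
      (by rwa [add_sub_cancel_left])
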